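/- Let $(\Omega,\mathcal F,\mathbb P)$ be a probability space and $d\ge 1$. Let $L^\infty$ and $L^\infty_d$ be the spaces of (almost sure classes of) essentially bounded random variables and $\mathbb R^d$-valued random vectors. Let $\rho\colon L^\infty\to\mathbb R$ be a convex monetary risk measure with the Fatou property, that is: $Y_1\ge Y_2$ a.s. implies $\rho(Y_1)\le\rho(Y_2)$; $\rho(Y+y)=\rho(Y)-y$ for $y\in\mathbb R$; $\rho(\gamma Y_1+(1-\gamma)Y_2)\le\gamma\rho(Y_1)+(1-\gamma)\rho(Y_2)$ for $\gamma\in[0,1]$; and $\rho(Y)\le\liminf_n\rho(Y_n)$ whenever $(Y_n)$ is bounded in $L^\infty$ and $Y_n\to Y$ a.s. Let $\mathcal A=\{Y\in L^\infty:\rho(Y)\le 0\}$. Let $\mathcal M(\mathbb P)$ be the set of probability measures absolutely continuous with respect to $\mathbb P$, $\mathcal M^e(\mathbb P)$ the set of those equivalent to $\mathbb P$, and $\mathcal M_d(\mathbb P)=\mathcal M(\mathbb P)^d$. Put $\alpha(\mathbb S)=\sup_{Y\in\mathcal A}\mathbb E^{\mathbb S}[-Y]$ for $\mathbb S\in\mathcal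 M(\mathbb P)$. An aggregation function is a non-constant concave function $\Lambda\colon\mathbb R^d\to\mathbb R$ that is increasing in the componentwise order. For such $\Lambda$ put $g(z)=\sup_{x\in\mathbb R^d}(\Lambda(x)-z^{\mathsf T}x)\in\mathbb R\cup\{+\infty\}$. For $\mathbb Q\in\mathcal M_d(\mathbb P)$ and $w\in\mathbb R^d_+\setminus\{0\}$ let $$\alpha^{\rm sys}(\mathbb Q,w)=\inf_{\mathbb S\in\mathcal M^e(\mathbb P)}\Big(\alpha(\mathbb S)+\mathbb E^{\mathbb S}\Big[g\Big(w_1\tfrac{d\mathbb Q_1}{d\mathbb S},\dots,w_d\tfrac{d\mathbb Q_d}{d\mathbb S}\Big)\Big]\Big),\qquad \tilde\alpha^{\rm sys}(\mathbb Q,w)=\inf_{\lambda>0}\frac{\alpha^{\rm sys}(\mathbb Q,\lambda w)}{\lambda},$$ and for $X\in L^\infty_d$ let $$\rho^{\rm ins}(X)=\rho(\Lambda(X)),\qquad \rho^{\rm sen}_w(X)=\inf\{w^{\mathsf T}z : z\in\mathbb R^d,\ \Lambda(X+z)\in\mathcal A\}\in\mathbb R\cup\{-\infty\}.$$ Write $w^{\mathsf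 T}\mathbb E^{\mathbb Q}[-X]=\sum_{i=1}^d w_i\,\mathbb E^{\mathbb Q_i}[-X_i]$ and $\mathbf 1=(1,\dots,1)^{\mathsf T}$. Let $\Lambda$ be an aggregation function such that $\rho(0)$ is an interior point of $\Lambda(\mathbb R^d)$, and assume that $\alpha(\mathbb S)<\infty$ for at least one $\mathbb S\in\mathcal M^e(\mathbb P)$. Then: 1. For every $X\in L^\infty_d$, $$\rho^{\rm ins}(X)=\sup_{\mathbb Q\in\mathcal M_d(\mathbb P),\,w\in\mathbb R^d_+\setminus\{0\}}\big(w^{\mathsf T}\mathbb E^{\mathbb Q}[-X]-\alpha^{\rm sys}(\mathbb Q,w)\big).$$ 2. For every $w\in\mathbb R^d_+\setminus\{0\}$ and $X\in L^\infty_d$, as an identity in $[-\infty,+\infty]$, $$\rho^{\rm sen}_w(X)=\sup_{\mathbb Q\in\mathcal M_d(\mathbb P)}\big(w^{\mathsf T}\mathbb E^{\mathbb Q}[-X]-\tilde\alpha^{\rm sys}(\mathbb Q,w)\big).$$ Moreover $\rho^{\rm ins}$ and $\rho^{\rm sen}_{\mathbf 1}$ do not coincide in general: for every $(\Omega,\mathcal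 F,\mathbb P)$, $d\ge1$ and $\rho$ as above there are an aggregation function $\Lambda$ with $\rho(0)$ in the interior of $\Lambda(\mathbb R^d)$ and an $X\in L^\infty_d$ with $\rho^{\rm ins}(X)\ne\rho^{\rm sen}_{\mathbf 1}(X)$. -/

import Mathlib

open MeasureTheory Filter Topology
open scoped ENNReal

noncomputable section

namespace SystemicRisk

variable {Ω : Type*} [MeasurableSpace Ω]

/-- Aggregation functions `Λ : ℝ^d → ℝ`: increasing for the componentwise order, concave,
and non-constant. -/
structure IsAggregation {d : ℕ} (Λ : (Fin d → ℝ) → ℝ) : Prop where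
  increasing : ∀ x z : Fin d → ℝ, x ≤ z → Λ x ≤ Λ z
  concave : ∀ x z : Fin d → ℝ, ∀ γ : ℝ, 0 ≤ γ → γ ≤ 1 →
    γ * Λ x + (1 - γ) * Λ z ≤ Λ (γ • x + (1 - γ) • z)
  nonconstant : ∃ x z : Fin d → ℝ, Λ x ≠ Λ z

/-- Convex monetary risk measures `ρ : L^∞(P) → ℝ` with the Fatou property. An element of `L^∞` is
given by a representative `Y` with `MemLp Y ∞ P`; `ρ` respects almost sure equality because
`monotone` refers to the almost sure order. Values of `ρ` off `L^∞` are never used. -/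
structure IsConvexRiskMeasure (P : Measure Ω) (ρ : (Ω → ℝ) → ℝ) : Prop where
  monotone : ∀ Y₁ Y₂ : Ω → ℝ, MemLp Y₁ ∞ P → MemLp Y₂ ∞ P →
    (∀ᵐ ω ∂P, Y₂ ω ≤ Y₁ ω) → ρ Y₁ ≤ ρ Y₂
  translative : ∀ (Y : Ω → ℝ) (y : ℝ), MemLp Y ∞ P → ρ (fun ω => Y ω + y) = ρ Y - y
  convex : ∀ (Y₁ Y₂ : Ω → ℝ) (γ : ℝ), MemLp Y₁ ∞ P → MemLp Y₂ ∞ P → 0 ≤ γ → γ ≤ 1 →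
    ρ (fun ω => γ * Y₁ ω + (1 - γ) * Y₂ ω) ≤ γ * ρ Y₁ + (1 - γ) * ρ Y₂
  fatou : ∀ (Yn : ℕ → Ω → ℝ) (Y : Ω → ℝ), (∀ n, MemLp (Yn n) ∞ P) → MemLp Y ∞ P →
    (∃ C : ℝ, ∀ n, ∀ᵐ ω ∂P, |Yn n ω| ≤ C) →
    (∀ᵐ ω ∂P, Tendsto (fun n => Yn n ω) atTop (𝓝 (Y ω))) →
    (ρ Y : EReal) ≤ liminf (fun n => (ρ (Yn n) : EReal)) atTop

/-- The acceptance set of `ρ`. -/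
def acceptanceSet (P : Measure Ω) (ρ : (Ω → ℝ) → ℝ) : Set (Ω → ℝ) :=
  {Y | MemLp Y ∞ P ∧ ρ Y ≤ 0}

/-- Probability measures absolutely continuous with respect to `P`. -/
def acMeasures (P : Measure Ω) : Set (Measure Ω) :=
  {Q | IsProbabilityMeasure Q ∧ Q ≪ P}

/-- Probability measures equivalent to `P`. -/
def equivMeasures (P : Measure Ω) : Set (Measure Ω) :=
  {S | IsProbabilityMeasure S ∧ S ≪ P ∧ P ≪ S}

/-- Vector probability measures whose components are absolutely continuous with respect to `P`. -/
def vectorMeasures (P : Measure Ω) (d : ℕ) : Set (Fin d → Measure Ω) :=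
  {Q | ∀ i, Q i ∈ acMeasures P}

/-- Weight vectors: `ℝ^d_+ \ {0}`. -/
def weights (d : ℕ) : Set (Fin d → ℝ) := {w | 0 ≤ w ∧ w ≠ 0}

/-- The minimal penalty function of `ρ`: the supremum of `E^S[-Y]` over acceptable `Y`. -/
def penalty (P : Measure Ω) (ρ : (Ω → ℝ) → ℝ) (S : Measure Ω) : EReal :=
  ⨆ Y ∈ acceptanceSet P ρ, ((∫ ω, -Y ω ∂S : ℝ) : EReal)

/-- The conjugate `g(z) = sup_x (Λ(x) - zᵀx)`. -/
def conj {d : ℕ} (Λ : (Fin d → ℝ) → ℝ) (z : Fin d → ℝ) : EReal :=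
  ⨆ x : Fin d → ℝ, ((Λ x - z ⬝ᵥ x : ℝ) : EReal)

/-- The expectation `E^S[f⁺] - E^S[f⁻]` of an extended real valued function. It is used only for
functions that are bounded below, where the second term is finite. -/
def extExpectation (S : Measure Ω) (f : Ω → EReal) : EReal :=
  ((∫⁻ ω, (f ω).toENNReal ∂S : ℝ≥0∞) : EReal) - ((∫⁻ ω, (-f ω).toENNReal ∂S : ℝ≥0∞) : EReal)

/-- The multivariate `g`-divergence `E^S[g(w · dQ/dS)]`. -/
def divergence {d : ℕ} (Λ : (Fin d → ℝ) → ℝ) (Q : Fin d → Measure Ω) (w : Fin d → ℝ)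
    (S : Measure Ω) : EReal :=
  extExpectation S fun ω => conj Λ fun i => w i * ((Q i).rnDeriv S ω).toReal

/-- The systemic penalty function `α^sys(Q, w)`. -/
def sysPenalty {d : ℕ} (P : Measure Ω) (ρ : (Ω → ℝ) → ℝ) (Λ : (Fin d → ℝ) → ℝ)
    (Q : Fin d → Measure Ω) (w : Fin d → ℝ) : EReal :=
  ⨅ S ∈ equivMeasures P, penalty P ρ S + divergence Λ Q w S

/-- The positively homogeneous function generated by `α^sys(Q, ·)`. -/
def sysPenaltyHom {d : ℕ} (P : Measure Ω) (ρ : (Ω → ℝ) → ℝ) (Λ : (Fin d → ℝ) → ℝ)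
    (Q : Fin d → Measure Ω) (w : Fin d → ℝ) : EReal :=
  ⨅ c : {c : ℝ // 0 < c}, sysPenalty P ρ Λ Q (c.1 • w) / (c.1 : EReal)

/-- The scalar insensitive systemic risk measure `ρ ∘ Λ`. -/
def rhoIns {d : ℕ} (ρ : (Ω → ℝ) → ℝ) (Λ : (Fin d → ℝ) → ℝ) (X : Ω → Fin d → ℝ) : ℝ :=
  ρ fun ω => Λ (X ω)

/-- The sensitive (set-valued) systemic risk measure. -/
def RSen {d : ℕ} (P : Measure Ω) (ρ : (Ω → ℝ) → ℝ) (Λ : (Fin d → ℝ) → ℝ)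
    (X : Ω → Fin d → ℝ) : Set (Fin d → ℝ) :=
  {z | (fun ω => Λ (X ω + z)) ∈ acceptanceSet P ρ}

/-- The scalarization of the sensitive systemic risk measure in direction `w`. -/
def rhoSen {d : ℕ} (P : Measure Ω) (ρ : (Ω → ℝ) → ℝ) (Λ : (Fin d → ℝ) → ℝ)
    (w : Fin d → ℝ) (X : Ω → Fin d → ℝ) : EReal :=
  ⨅ z ∈ RSen P ρ Λ X, ((w ⬝ᵥ z : ℝ) : EReal)

/-- The weighted expectation `wᵀ E^Q[-X]`. -/
def weightedLoss {d : ℕ} (Q : Fin d → Measure Ω) (w : Fin d → ℝ) (X : Ω → Fin d → ℝ) : ℝ :=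
  ∑ i, w i * ∫ ω, -X ω i ∂(Q i)

end SystemicRisk

end

/-! Both formulas are Fenchel duality for the convex, decreasing function `F z = ρ (Λ (X + z))` of
the deterministic capital `z`. Weak duality tests the penalty with the acceptable position `Λ(X) +
ρ(Λ(X))` and the conjugate `g` with the point `X ω`, then integrates.

The hard direction is `IsAggregation.exists_sysPenalty_le`: every affine minorant `c - v ⬝ᵥ z` of
`F` with `v ≥ 0` yields `Q` with `α^sys(Q, v) ≤ vᵀE^Q[-X] - c + ε`. Rounding `X` down to finitely
many values reduces this to finite-dimensional duality (`IsAggregation.exists_dual`), which gives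
cell weights `s` and a slope for each cell. By `IsConvexRiskMeasure.exists_approx` the weights are
nearly the cell probabilities of a measure with almost the right penalty. Mixing in a little of an
equivalent measure of finite penalty gives `S` equivalent to `P`; the surplus mass carries the
constant slope `v`, whose conjugate is finite, so the slopes still average to `v` and define
`dQ/dS`. The approximation rests on the robust representation of `ρ`, obtained from a Krein-Smulian
separation in `L^∞`.

The insensitive formula uses a minorant of nonzero slope that almost touches `F` at `0`. The
sensitive one uses a Lagrange multiplier `μ > 0` for the constraint `F z ≤ 0`, with a Slater point
supplied by the interior condition; the scaling in the penalty is `λ = 1/μ`. For `Λ x = 2 ∑ x i`,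
one unit of capital changes the aggregate by two, so the two measures differ already on constants.
-/

noncomputable section

namespace SystemicRisk

/-! ### Separation, minimax and weak compactness -/

/-- Sandwich theorem: a continuous convex function that dominates a convex set of points
`(y, t)` (in the sense `t ≤ Φ y`) is separated from it by an affine function. -/
theorem exists_affine_between {E : Type*} [NormedAddCommGroup E] [NormedSpace ℝ E]
    {Φ : E → ℝ} (hΦ : ConvexOn ℝ Set.univ Φ) (hc : Continuous Φ)
    {K : Set (E × ℝ)} (hK : Convex ℝ K) (hne : K.Nonempty)
    (hle : ∀ p ∈ K, p.2 ≤ Φ p.1) :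
    ∃ (f : StrongDual ℝ E) (b : ℝ), (∀ y, f y - b ≤ Φ y) ∧ ∀ p ∈ K, p.2 ≤ f p.1 - b := by
  have hopen : IsOpen {p : E × ℝ | Φ p.1 < p.2} :=
    isOpen_lt (hc.comp continuous_fst) continuous_snd
  have hconv : Convex ℝ {p : E × ℝ | Φ p.1 < p.2} := by
    have := hΦ.convex_strict_epigraph
    simpa using this
  have hdisj : Disjoint {p : E × ℝ | Φ p.1 < p.2} K := by
    rw [Set.disjoint_left]
    intro p hp hpK
    exact absurd (hle p hpK) (not_le.2 hp)
  obtain ⟨g, κ, h1, h2⟩ := geometric_hahn_banach_open hconv hopen hK hdisj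
  have hg : ∀ y t, g (y, t) = g (y, 0) + t * g (0, 1) := by
    intro y t
    have : ((y, t) : E × ℝ) = (y, 0) + t • (0, 1) := by simp
    rw [this, map_add, map_smul, smul_eq_mul]
  set τ := g (0, 1) with hτ
  obtain ⟨⟨y0, t0⟩, hp0⟩ := hne
  have hk0 := h2 _ hp0
  have hu0 := h1 (y0, Φ y0 + 1) (by simp)
  have hle0 := hle _ hp0
  rw [hg] at hk0 hu0
  -- Over the same base point `y0` the epigraph lies above a point of `K`, so the separating
  -- hyperplane is not vertical and can be solved for the second coordinate.
  have hτneg : τ < 0 := by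
    by_contra hcon
    push Not at hcon
    simp only at hle0
    nlinarith
  let f : StrongDual ℝ E := (-τ)⁻¹ • (g.comp (ContinuousLinearMap.inl ℝ E ℝ))
  have hf : ∀ y, (-τ) * f y = g (y, 0) := by
    intro y
    simp only [f, smul_apply, ContinuousLinearMap.comp_apply,
      ContinuousLinearMap.inl_apply, smul_eq_mul]
    rw [← mul_assoc, mul_inv_cancel₀ (by linarith), one_mul]
  refine ⟨f, (-τ)⁻¹ * κ, ?_, ?_⟩
  · intro y
    have hb : (-τ) * ((-τ)⁻¹ * κ) = κ := by
      rw [← mul_assoc, mul_inv_cancel₀ (by linarith), one_mul]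
    by_contra hcon
    push Not at hcon
    have := h1 (y, f y - (-τ)⁻¹ * κ) hcon
    rw [hg, ← hf] at this
    nlinarith
  · rintro ⟨y, t⟩ hp
    have hb : (-τ) * ((-τ)⁻¹ * κ) = κ := by
      rw [← mul_assoc, mul_inv_cancel₀ (by linarith), one_mul]
    have := h2 _ hp
    rw [hg, ← hf] at this
    by_contra hcon
    push Not at hcon
    simp only at hcon
    nlinarith

/-- A minimax principle: if every functional of a convex family reaches the level one on a compact
convex set, then one point of the set serves the whole family. -/
theorem exists_forall_one_le_of_isCompact {E : Type*} [NormedAddCommGroup E] [NormedSpace ℝ E]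
    {K : Set E} (hK : IsCompact K) (hKc : Convex ℝ K) (hKne : K.Nonempty)
    {Φ : Set (StrongDual ℝ E)} (hΦ : Convex ℝ Φ) (h : ∀ φ ∈ Φ, ∃ x ∈ K, 1 ≤ φ x) :
    ∃ x ∈ K, ∀ φ ∈ Φ, 1 ≤ φ x := by
  classical
  -- Compactness reduces the claim to finitely many functionals. If no point served them all, the
  -- image of `K` in `s → ℝ` would miss the orthant above `1`; the separating functional has
  -- nonnegative coefficients, and normalised it is a member of `Φ` that stays below one on `K`.
  have key : ∀ s : Finset Φ, (K ∩ ⋂ φ ∈ s, {x | 1 ≤ (φ : StrongDual ℝ E) x}).Nonempty := by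
    intro s
    by_contra hemp
    rw [Set.not_nonempty_iff_eq_empty] at hemp
    let T : E →L[ℝ] (s → ℝ) := ContinuousLinearMap.pi fun i => (i : Φ).1
    have hTK : IsCompact (T '' K) := hK.image T.continuous
    have hTc : Convex ℝ (T '' K) := hKc.linear_image T.toLinearMap
    have hOcl : IsClosed (Set.Ici (1 : s → ℝ)) := isClosed_Ici
    have hdisj : Disjoint (T '' K) (Set.Ici (1 : s → ℝ)) := by
      rw [Set.disjoint_left]
      rintro _ ⟨x, hx, rfl⟩ hO
      have : x ∈ K ∩ ⋂ φ ∈ s, {x | 1 ≤ (φ : StrongDual ℝ E) x} := by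
        refine ⟨hx, ?_⟩
        simp only [Set.mem_iInter, Set.mem_ofPred_eq]
        intro φ hφ
        exact hO ⟨φ, hφ⟩
      rw [hemp] at this
      exact this
    obtain ⟨f, a, b, ha, hab, hb⟩ :=
      geometric_hahn_banach_compact_closed hTc hTK (convex_Ici _) hOcl hdisj
    let c : s → ℝ := fun i => f (Pi.single i 1)
    have hf : ∀ u : s → ℝ, f u = ∑ i, c i * u i := by
      intro u
      conv_lhs => rw [← Finset.univ_sum_single u]
      rw [map_sum]
      refine Finset.sum_congr rfl fun i _ => ?_
      have : (Pi.single i (u i) : s → ℝ) = u i • Pi.single i 1 := by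
        rw [← Pi.single_smul]; simp
      rw [this, map_smul, smul_eq_mul, mul_comm]
    have hone : b < ∑ i, c i := by
      have := hb 1 (by simp)
      rw [hf] at this
      simpa using this
    have hc : ∀ i, 0 ≤ c i := by
      intro i
      by_contra hcon
      push Not at hcon
      set t := (∑ i, c i - b) / (-c i)
      have ht : 0 ≤ t := div_nonneg (by linarith) (by linarith)
      have := hb (1 + t • Pi.single i 1) (by
        intro j
        simp only [Pi.add_apply, Pi.smul_apply, smul_eq_mul, Pi.one_apply]
        have : (0 : ℝ) ≤ (Pi.single i 1 : s → ℝ) j := by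
          by_cases hj : j = i
          · subst hj; simp
          · simp [hj]
        nlinarith)
      rw [map_add, map_smul, hf 1] at this
      have h3 : t * (-c i) = ∑ i, c i - b := div_mul_cancel₀ _ (by linarith)
      simp only [Pi.one_apply, mul_one, smul_eq_mul] at this
      change b < ∑ i, c i + t * c i at this
      linarith
    obtain ⟨x0, hx0⟩ := hKne
    have hTx : ∀ x, f (T x) = ∑ i, c i * (i : Φ).1 x := fun x => hf _
    have hσ : 0 < ∑ i, c i := by
      refine lt_of_le_of_ne (Finset.sum_nonneg fun i _ => hc i) fun h0 => ?_
      have hz := (Finset.sum_eq_zero_iff_of_nonneg fun i _ => hc i).1 h0.symm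
      have h1 := ha _ ⟨x0, hx0, rfl⟩
      rw [hTx, Finset.sum_eq_zero fun i hi => by rw [hz i hi, zero_mul]] at h1
      linarith
    set σ := ∑ i, c i
    have hmem : ∑ i, (σ⁻¹ * c i) • (i : Φ).1 ∈ Φ := by
      refine hΦ.sum_mem (fun i _ => mul_nonneg (inv_nonneg.2 hσ.le) (hc i)) ?_
        fun i _ => (i : Φ).2
      rw [← Finset.mul_sum]
      exact inv_mul_cancel₀ hσ.ne'
    obtain ⟨x, hx, hx1⟩ := h _ hmem
    have h1 := ha _ ⟨x, hx, rfl⟩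
    rw [hTx] at h1
    have h2 : (∑ i, (σ⁻¹ * c i) • (i : Φ).1) x = σ⁻¹ * ∑ i, c i * (i : Φ).1 x := by
      rw [sum_apply, Finset.mul_sum]
      exact Finset.sum_congr rfl fun i _ => by simp [mul_assoc]
    rw [h2] at hx1
    have h3 : σ ≤ ∑ i, c i * (i : Φ).1 x := by
      have := mul_le_mul_of_nonneg_left hx1 hσ.le
      rwa [mul_one, ← mul_assoc, mul_inv_cancel₀ hσ.ne', one_mul] at this
    linarith
  have hclosed : ∀ φ : Φ, IsClosed {x | 1 ≤ (φ : StrongDual ℝ E) x} := fun φ =>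
    isClosed_le continuous_const φ.1.continuous
  obtain ⟨x, hx, hx'⟩ := hK.inter_iInter_nonempty _ hclosed key
  refine ⟨x, hx, fun φ hφ => ?_⟩
  exact Set.mem_iInter.1 hx' ⟨φ, hφ⟩

/-- Weak compactness of closed bounded convex sets of a Hilbert space, in covering form. -/
theorem exists_finset_forall_one_lt_inner {H : Type*} [NormedAddCommGroup H]
    [InnerProductSpace ℝ H] [CompleteSpace H] {K : Set H} (hK : Convex ℝ K) (hcl : IsClosed K)
    {R : ℝ} (hR : ∀ y ∈ K, ‖y‖ ≤ R) {F : Set H} (hF : ∀ y ∈ K, ∃ f ∈ F, 1 < inner ℝ y f) :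
    ∃ s : Finset H, ↑s ⊆ F ∧ ∀ y ∈ K, ∃ f ∈ s, 1 < inner ℝ y f := by
  classical
  rcases K.eq_empty_or_nonempty with rfl | hKne
  · exact ⟨∅, by simp, by simp⟩
  let ι : H → WeakDual ℝ H := fun y =>
    StrongDual.toWeakDual (InnerProductSpace.toDual ℝ H y)
  have hι : ∀ y f, ι y f = inner ℝ y f := fun y f => rfl
  have hcomp : IsCompact (ι '' K) := by
    refine IsCompact.of_isClosed_subset (WeakDual.isCompact_closedBall (𝕜 := ℝ) (E := H) 0 R)
      ?_ ?_
    -- Hahn-Banach writes `K` as an intersection of half-spaces bounded by its support function;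
    -- under the Riesz map each is weak-* closed.
    · have : ι '' K = ⋂ l : StrongDual ℝ H,
          {φ : WeakDual ℝ H | φ ((InnerProductSpace.toDual ℝ H).symm l) ≤ sSup (l '' K)} := by
        have hbdd : ∀ l : StrongDual ℝ H, BddAbove (l '' K) := by
          intro l
          refine ⟨‖l‖ * R, ?_⟩
          rintro _ ⟨y, hy, rfl⟩
          exact (le_abs_self _).trans ((l.le_opNorm y).trans
            (mul_le_mul_of_nonneg_left (hR y hy) (norm_nonneg _)))
        ext φ
        simp only [Set.mem_image, Set.mem_iInter, Set.mem_ofPred_eq]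
        constructor
        · rintro ⟨y, hy, rfl⟩ l
          rw [hι, real_inner_comm, InnerProductSpace.toDual_symm_apply]
          exact le_csSup (hbdd l) ⟨y, hy, rfl⟩
        · intro hφ
          obtain ⟨y, rfl⟩ : ∃ y, ι y = φ :=
            ⟨(InnerProductSpace.toDual ℝ H).symm (WeakDual.toStrongDual φ), by
              refine DFunLike.ext _ _ fun f => ?_
              rw [hι, InnerProductSpace.toDual_symm_apply]
              rfl⟩
          refine ⟨y, ?_, rfl⟩
          by_contra hy
          obtain ⟨l, u, hl, hu⟩ := geometric_hahn_banach_closed_point hK hcl hy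
          have h1 := hφ l
          rw [hι, real_inner_comm, InnerProductSpace.toDual_symm_apply] at h1
          have h2 : sSup (l '' K) ≤ u := by
            refine csSup_le (hKne.image _) ?_
            rintro _ ⟨z, hz, rfl⟩
            exact (hl z hz).le
          linarith
      rw [this]
      refine isClosed_iInter fun l => isClosed_le ?_ continuous_const
      exact WeakDual.eval_continuous _
    · rintro _ ⟨y, hy, rfl⟩
      simp only [Set.mem_preimage, Metric.mem_closedBall, dist_zero_right]
      change ‖InnerProductSpace.toDual ℝ H y‖ ≤ R
      rw [LinearIsometryEquiv.norm_map]
      exact hR y hy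
  obtain ⟨t, ht⟩ := hcomp.elim_finite_subcover (fun f : F => {φ : WeakDual ℝ H | 1 < φ f.1})
    (fun f => isOpen_lt continuous_const (WeakDual.eval_continuous _)) (by
      rintro _ ⟨y, hy, rfl⟩
      obtain ⟨f, hf, h1⟩ := hF y hy
      exact Set.mem_iUnion.2 ⟨⟨f, hf⟩, h1⟩)
  refine ⟨t.image Subtype.val, ?_, ?_⟩
  · intro f hf
    simp only [Finset.coe_image, Set.mem_image] at hf
    obtain ⟨g, -, rfl⟩ := hf
    exact g.2
  · intro y hy
    have := ht ⟨y, hy, rfl⟩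
    simp only [Set.mem_iUnion, Set.mem_ofPred_eq] at this
    obtain ⟨f, hft, hf⟩ := this
    exact ⟨f.1, Finset.mem_image_of_mem _ hft, hf⟩

/-! ### Krein-Smulian separation in `L^∞` -/

section

variable {Ω : Type*} [MeasurableSpace Ω]

theorem exists_ae_abs_le {P : Measure Ω} {Y : Ω → ℝ} (hY : MemLp Y ∞ P) :
    ∃ c : ℝ, ∀ᵐ ω ∂P, |Y ω| ≤ c := by
  refine ⟨(eLpNorm Y ∞ P).toReal, ?_⟩
  filter_upwards [ae_le_eLpNormEssSup (f := Y) (μ := P)] with ω h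
  rw [← eLpNorm_exponent_top] at h
  simpa using ENNReal.toReal_mono hY.eLpNorm_ne_top h

/-- A bound in `L^∞` that fails is detected by an element of `L^2` with small `L^1`-norm. -/
theorem exists_one_lt_integral_of_not_ae_le (P : Measure Ω) [IsProbabilityMeasure P]
    {m : ℝ} (hm : 0 < m) (y : Lp ℝ 2 P) (hy : ¬ ∀ᵐ ω ∂P, |y ω| ≤ m) :
    ∃ f : Lp ℝ 2 P, ∫ ω, |f ω| ∂P ≤ 1 / m ∧ 1 < ∫ ω, f ω * y ω ∂P := by
  have hym : Measurable y := (Lp.stronglyMeasurable y).measurable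
  set B : Set Ω := {ω | m < |y ω|} with hB
  have hBm : MeasurableSet B := measurableSet_lt measurable_const (by fun_prop)
  have hBpos : P B ≠ 0 := by
    intro h0
    exact hy (by rw [ae_iff]; simpa [hB] using h0)
  have hBr : 0 < P.real B := ENNReal.toReal_pos hBpos (measure_ne_top _ _)
  -- The test function is the sign of `y` on `B`, scaled by `c`: its `L^1`-norm is at most `c * P B
  -- = 1 / m`, and its pairing with `y` is the mean of `|y| / m` over `B`, which exceeds one.
  set c : ℝ := (P.real B * m)⁻¹ with hc
  have hcpos : 0 < c := by positivity
  set φ : Ω → ℝ := B.indicator fun ω => c * (y ω / |y ω|) with hφ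
  have hφm : Measurable φ := (by fun_prop : Measurable fun ω => c * (y ω / |y ω|)).indicator hBm
  have habs : ∀ ω, |φ ω| ≤ B.indicator (fun _ => c) ω := by
    intro ω
    by_cases h : ω ∈ B
    · simp only [hφ, Set.indicator_of_mem h, abs_mul, abs_div, abs_abs, abs_of_pos hcpos]
      exact mul_le_of_le_one_right hcpos.le (div_self_le_one _)
    · simp [hφ, Set.indicator_of_notMem h]
  have hφL : MemLp φ 2 P := by
    refine (memLp_top_of_bound hφm.aestronglyMeasurable c (ae_of_all _ fun ω => ?_)).mono_exponent
      le_top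
    refine (habs ω).trans ?_
    exact Set.indicator_le_self' (fun _ _ => hcpos.le) ω
  have hye : Integrable y P := (Lp.memLp y).integrable (by norm_num)
  refine ⟨hφL.toLp φ, ?_, ?_⟩
  · have h1 : ∫ ω, |(hφL.toLp φ) ω| ∂P = ∫ ω, |φ ω| ∂P :=
      integral_congr_ae (by filter_upwards [hφL.coeFn_toLp] with ω h; rw [h])
    rw [h1]
    calc ∫ ω, |φ ω| ∂P ≤ ∫ ω, B.indicator (fun _ => c) ω ∂P := by
          refine integral_mono (hφL.integrable (by norm_num)).abs
            ((integrable_const c).indicator hBm) habs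
      _ = P.real B * c := by rw [integral_indicator hBm]; simp
      _ = 1 / m := by rw [hc]; field_simp
  · have h1 : ∫ ω, (hφL.toLp φ) ω * y ω ∂P = ∫ ω, B.indicator (fun ω => c * |y ω|) ω ∂P := by
      refine integral_congr_ae ?_
      filter_upwards [hφL.coeFn_toLp] with ω h
      rw [h]
      by_cases hω : ω ∈ B
      · have : 0 < |y ω| := hm.trans hω
        simp only [hφ, Set.indicator_of_mem hω]
        rw [mul_assoc, div_mul_eq_mul_div, ← abs_mul_abs_self (y ω), mul_self_div_self]
      · simp [hφ, Set.indicator_of_notMem hω]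
    rw [h1, integral_indicator hBm, integral_const_mul]
    have h2 : 0 < ∫ ω in B, (|y ω| - m) ∂P := by
      rw [setIntegral_pos_iff_support_of_nonneg_ae]
      · have : (Function.support fun ω => |y ω| - m) ∩ B = B := by
          ext ω
          simp only [Set.mem_inter_iff, Function.mem_support, and_iff_right_iff_imp]
          intro h
          exact (sub_pos.2 h).ne'
        rw [this]
        exact pos_iff_ne_zero.2 hBpos
      · filter_upwards [ae_restrict_mem hBm] with ω h
        exact (sub_pos.2 h).le
      · exact (hye.abs.sub (integrable_const m)).integrableOn
    rw [integral_sub hye.abs.integrableOn (integrable_const m)] at h2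
    simp only [integral_const, MeasurableSet.univ, measureReal_restrict_apply, Set.univ_inter,
      smul_eq_mul] at h2
    have h3 : c * (P.real B * m) = 1 := inv_mul_cancel₀ (by positivity)
    nlinarith

theorem inner_Lp_two_eq_integral (P : Measure Ω) (y f : Lp ℝ 2 P) :
    inner ℝ y f = ∫ ω, f ω * y ω ∂P := by
  rw [L2.inner_def]
  simp

/-- The exhausting sequence of finite sets in the proof of the Krein-Smulian theorem: members of
`K n` are detected by a finite set, and what is added at step `n` has small `L^1`-norm. -/
theorem exists_seq_finset_detecting (P : Measure Ω) [IsProbabilityMeasure P] {r : ℝ} (hr : 0 < r)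
    {K : ℕ → Set (Lp ℝ 2 P)} (hconv : ∀ n, Convex ℝ (K n)) (hcl : ∀ n, IsClosed (K n))
    (hbdd : ∀ n, ∀ y ∈ K n, ∀ᵐ ω ∂P, |y ω| ≤ (n + 1) * r)
    (hmono : ∀ n, ∀ y ∈ K (n + 1), (∀ᵐ ω ∂P, |y ω| ≤ (n + 1) * r) → y ∈ K n)
    (hK0 : K 0 = ∅) :
    ∃ U : ℕ → Finset (Lp ℝ 2 P), (∀ n, ∀ y ∈ K n, ∃ f ∈ U n, 1 < ∫ ω, f ω * y ω ∂P) ∧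
      (∀ n, U n ⊆ U (n + 1)) ∧
      ∀ n, ∀ f ∈ U (n + 1), f ∈ U n ∨ ∫ ω, |f ω| ∂P ≤ 1 / ((n + 1) * r) := by
  classical
  let St : ℕ → Type _ := fun n =>
    {U : Finset (Lp ℝ 2 P) // ∀ y ∈ K n, ∃ f ∈ U, 1 < ∫ ω, f ω * y ω ∂P}
  have step : ∀ n (U : St n), ∃ V : St (n + 1), U.1 ⊆ V.1 ∧
      ∀ f ∈ V.1, f ∈ U.1 ∨ ∫ ω, |f ω| ∂P ≤ 1 / ((n + 1) * r) := by
    rintro n ⟨U, hU⟩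
    have hm : 0 < ((n : ℝ) + 1) * r := by positivity
    -- `K'` collects what `U` fails to detect. Its members violate the bound `(n + 1) * r`, as
    -- otherwise they would lie in `K n`; hence functions of `L^1`-norm at most `1 / ((n + 1) * r)`
    -- detect them, and by weak compactness finitely many suffice.
    let K' : Set (Lp ℝ 2 P) := K (n + 1) ∩ ⋂ f ∈ U, {y | inner ℝ y f ≤ 1}
    have hK'c : Convex ℝ K' := by
      refine (hconv _).inter (convex_iInter₂ fun f _ => ?_)
      have : {y : Lp ℝ 2 P | inner ℝ y f ≤ 1} = {y | innerSL ℝ f y ≤ 1} := by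
        ext y; simp [real_inner_comm]
      rw [this]
      exact convex_halfSpace_le (innerSL ℝ f).isLinear 1
    have hK'cl : IsClosed K' := by
      refine (hcl _).inter (isClosed_biInter fun f _ => ?_)
      exact isClosed_le (by fun_prop) continuous_const
    obtain ⟨s, hs, hs'⟩ := exists_finset_forall_one_lt_inner (K := K')
      (R := (measureUnivNNReal P : ℝ) ^ (2 : ℝ≥0∞).toReal⁻¹ * (((n + 1 : ℕ) + 1) * r))
      (F := {f | ∫ ω, |f ω| ∂P ≤ 1 / ((n + 1) * r)}) hK'c hK'cl
      (fun y hy => Lp.norm_le_of_ae_bound (by positivity) (hbdd _ y hy.1)) (by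
        rintro y ⟨hy, hyU⟩
        have hny : ¬ ∀ᵐ ω ∂P, |y ω| ≤ (n + 1) * r := by
          intro hle
          obtain ⟨f, hf, h1⟩ := hU y (hmono n y hy hle)
          simp only [Set.mem_iInter, Set.mem_ofPred_eq] at hyU
          have := hyU f hf
          rw [inner_Lp_two_eq_integral] at this
          linarith
        obtain ⟨f, hf, h1⟩ := exists_one_lt_integral_of_not_ae_le P hm y hny
        exact ⟨f, hf, by rwa [inner_Lp_two_eq_integral]⟩)
    refine ⟨⟨U ∪ s, ?_⟩, Finset.subset_union_left, ?_⟩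
    · intro y hy
      by_cases hyU : ∃ f ∈ U, 1 < ∫ ω, f ω * y ω ∂P
      · obtain ⟨f, hf, h1⟩ := hyU
        exact ⟨f, Finset.mem_union_left _ hf, h1⟩
      · push Not at hyU
        obtain ⟨f, hf, h1⟩ := hs' y ⟨hy, by
          simp only [Set.mem_iInter, Set.mem_ofPred_eq]
          intro f hf
          rw [inner_Lp_two_eq_integral]
          exact hyU f hf⟩
        exact ⟨f, Finset.mem_union_right _ hf, by rwa [inner_Lp_two_eq_integral] at h1⟩
    · intro f hf
      rcases Finset.mem_union.1 hf with h | h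
      · exact Or.inl h
      · exact Or.inr (hs h)
  choose g hg1 hg2 using step
  let U : ∀ n, St n := fun n => Nat.rec (motive := St) ⟨∅, by simp [hK0]⟩ g n
  exact ⟨fun n => (U n).1, fun n => (U n).2, fun n => hg1 n (U n), fun n => hg2 n (U n)⟩

/-- The inclusion of `L^2` in `L^1` over a probability space. -/
def toLpOne (P : Measure Ω) [IsProbabilityMeasure P] (f : Lp ℝ 2 P) : Lp ℝ 1 P :=
  ((Lp.memLp f).mono_exponent (by norm_num : (1 : ℝ≥0∞) ≤ 2)).toLp f

theorem toLpOne_ae (P : Measure Ω) [IsProbabilityMeasure P] (f : Lp ℝ 2 P) :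
    toLpOne P f =ᵐ[P] f := MemLp.coeFn_toLp _

/-- Detection takes place in `L^2`, where bounded sets are weakly compact, while smallness is
measured in `L^1`, the predual of `L^∞`. -/
theorem norm_toLpOne (P : Measure Ω) [IsProbabilityMeasure P] (f : Lp ℝ 2 P) :
    ‖toLpOne P f‖ = ∫ ω, |f ω| ∂P := by
  rw [L1.norm_eq_integral_norm]
  refine integral_congr_ae ?_
  filter_upwards [toLpOne_ae P f] with ω h
  rw [h, Real.norm_eq_abs]

/-- The Krein-Smulian theorem for `L^∞`, as a separation statement: a convex set that is closed
under bounded almost sure limits and avoids a ball around zero is separated from zero by an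
integrable function. -/
theorem exists_integrable_forall_one_le_integral (P : Measure Ω) [IsProbabilityMeasure P]
    {C : Set (Ω → ℝ)} (hmem : ∀ Y ∈ C, MemLp Y ∞ P)
    (hcongr : ∀ Y Y' : Ω → ℝ, Y ∈ C → Y' =ᵐ[P] Y → Y' ∈ C) (hconv : Convex ℝ C)
    (hclosed : ∀ (Yn : ℕ → Ω → ℝ) (Y : Ω → ℝ), (∀ n, Yn n ∈ C) → MemLp Y ∞ P →
      (∃ c : ℝ, ∀ n, ∀ᵐ ω ∂P, |Yn n ω| ≤ c) →
      (∀ᵐ ω ∂P, Tendsto (fun n => Yn n ω) atTop (𝓝 (Y ω))) → Y ∈ C)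
    {r : ℝ} (hr : 0 < r) (hsep : ∀ Y ∈ C, ¬ ∀ᵐ ω ∂P, |Y ω| ≤ r) :
    ∃ h : Ω → ℝ, Integrable h P ∧ ∀ Y ∈ C, 1 ≤ ∫ ω, h ω * Y ω ∂P := by
  classical
  -- Bounded slices of `C`, seen in `L^2`: a norm convergent sequence has an almost surely
  -- convergent subsequence, so closure under bounded limits becomes norm closedness. The slice `K
  -- 0` is empty because `C` avoids the ball of radius `r`.
  let K : ℕ → Set (Lp ℝ 2 P) := fun n =>
    {y | (y : Ω → ℝ) ∈ C ∧ ∀ᵐ ω ∂P, |y ω| ≤ (n + 1) * r}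
  have hKconv : ∀ n, Convex ℝ (K n) := by
    rintro n x ⟨hx, hxb⟩ y ⟨hy, hyb⟩ a b ha hb hab
    have hco : ((a • x + b • y : Lp ℝ 2 P) : Ω → ℝ) =ᵐ[P] a • (x : Ω → ℝ) + b • (y : Ω → ℝ) := by
      filter_upwards [Lp.coeFn_add (a • x) (b • y), Lp.coeFn_smul a x, Lp.coeFn_smul b y]
        with ω h1 h2 h3
      rw [h1, Pi.add_apply, h2, h3]
      rfl
    refine ⟨hcongr _ _ (hconv hx hy ha hb hab) hco, ?_⟩
    filter_upwards [hco, hxb, hyb] with ω h1 h2 h3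
    rw [h1]
    calc |a * x ω + b * y ω| ≤ |a * x ω| + |b * y ω| := abs_add_le _ _
      _ = a * |x ω| + b * |y ω| := by rw [abs_mul, abs_mul, abs_of_nonneg ha, abs_of_nonneg hb]
      _ ≤ a * ((n + 1) * r) + b * ((n + 1) * r) := by gcongr
      _ = (n + 1) * r := by rw [← add_mul, hab, one_mul]
  have hKcl : ∀ n, IsClosed (K n) := by
    intro n
    refine IsSeqClosed.isClosed fun x y hx hxy => ?_
    obtain ⟨ns, -, hns⟩ := (tendstoInMeasure_of_tendsto_Lp hxy).exists_seq_tendsto_ae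
    have hyb : ∀ᵐ ω ∂P, |y ω| ≤ (n + 1) * r := by
      have hall : ∀ᵐ ω ∂P, ∀ k, |x k ω| ≤ (n + 1) * r := ae_all_iff.2 fun k => (hx k).2
      filter_upwards [hns, hall] with ω h1 h2
      exact le_of_tendsto h1.abs (Eventually.of_forall fun k => h2 _)
    refine ⟨hclosed (fun k => x (ns k)) y (fun k => (hx _).1) ?_ ⟨_, fun k => (hx _).2⟩ hns, hyb⟩
    exact memLp_top_of_bound (Lp.aestronglyMeasurable y) _ hyb
  have hK0 : K 0 = ∅ := by
    rw [Set.eq_empty_iff_forall_notMem]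
    rintro y ⟨hy, hyb⟩
    exact hsep _ hy (by simpa using hyb)
  obtain ⟨U, hU, hUmono, hUsmall⟩ := exists_seq_finset_detecting P hr hKconv hKcl
    (fun n y hy => hy.2) (fun n y hy hle => ⟨hy.1, hle⟩) hK0
  have hUle : ∀ m n, m ≤ n → U m ⊆ U n := fun m n h => monotone_nat_of_le_succ hUmono h
  have hUtail : ∀ N m, ∀ f ∈ U m, f ∈ U N ∨ ∫ ω, |f ω| ∂P ≤ 1 / ((N + 1) * r) := by
    intro N m
    induction m with
    | zero => exact fun f hf => Or.inl (hUle 0 N (Nat.zero_le _) hf)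
    | succ m ih =>
      intro f hf
      by_cases hmN : m + 1 ≤ N
      · exact Or.inl (hUle _ _ hmN hf)
      · rcases hUsmall m f hf with h | h
        · exact ih f h
        · right
          have : (N : ℝ) ≤ m := by exact_mod_cast (by omega : N ≤ m)
          refine h.trans (one_div_le_one_div_of_le (by positivity) ?_)
          gcongr
  -- All but finitely many detecting functions are small in `L^1`, so `D` is totally bounded and its
  -- closed convex hull compact. The minimax principle on this hull then finds one `h` for all of
  -- `C`.
  let D : Set (Lp ℝ 1 P) := insert 0 (⋃ n, toLpOne P '' (U n : Set (Lp ℝ 2 P)))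
  have hD : TotallyBounded D := by
    rw [Metric.totallyBounded_iff]
    intro ε hε
    obtain ⟨N, hN⟩ := exists_nat_gt (1 / (ε * r))
    have hNε : 1 / (((N : ℝ) + 1) * r) < ε := by
      rw [div_lt_iff₀ (by positivity)] at hN ⊢
      nlinarith [mul_pos hε hr]
    refine ⟨insert 0 (toLpOne P '' (U N : Set (Lp ℝ 2 P))),
      ((U N).finite_toSet.image _).insert 0, ?_⟩
    rintro x (rfl | hx)
    · exact Set.mem_biUnion (Set.mem_insert _ _) (Metric.mem_ball_self hε)
    · obtain ⟨m, f, hf, rfl⟩ := Set.mem_iUnion.1 hx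
      rcases hUtail N m f hf with h | h
      · exact Set.mem_biUnion (Set.mem_insert_of_mem _ ⟨f, h, rfl⟩) (Metric.mem_ball_self hε)
      · refine Set.mem_biUnion (Set.mem_insert _ _) ?_
        rw [mem_ball_zero_iff, norm_toLpOne]
        exact h.trans_lt hNε
  have hDK : D ⊆ closure (convexHull ℝ D) := (subset_convexHull ℝ D).trans subset_closure
  let Φ : Set (StrongDual ℝ (Lp ℝ 1 P)) := {φ | ∃ Y ∈ C, ∀ h, φ h = ∫ ω, h ω * Y ω ∂P}
  have hΦ : Convex ℝ Φ := by
    rintro φ₁ ⟨Y₁, hY₁, h₁⟩ φ₂ ⟨Y₂, hY₂, h₂⟩ a b ha hb hab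
    refine ⟨a • Y₁ + b • Y₂, hconv hY₁ hY₂ ha hb hab, fun h => ?_⟩
    have hi : Integrable h P := L1.integrable_coeFn h
    have e1 : Integrable (fun ω => h ω * Y₁ ω) P := hi.mul_of_top_left (hmem _ hY₁)
    have e2 : Integrable (fun ω => h ω * Y₂ ω) P := hi.mul_of_top_left (hmem _ hY₂)
    calc (a • φ₁ + b • φ₂) h = a * φ₁ h + b * φ₂ h := rfl
      _ = ∫ ω, a * (h ω * Y₁ ω) + b * (h ω * Y₂ ω) ∂P := by
        rw [integral_add (e1.const_mul a) (e2.const_mul b), integral_const_mul,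
          integral_const_mul, h₁, h₂]
      _ = ∫ ω, h ω * (a • Y₁ + b • Y₂) ω ∂P := by
        congr 1
        ext ω
        simp only [Pi.add_apply, Pi.smul_apply, smul_eq_mul]
        ring
  obtain ⟨h, -, hh⟩ := exists_forall_one_le_of_isCompact (K := closure (convexHull ℝ D))
    (hD.convexHull.closure.isCompact_of_isClosed isClosed_closure)
    (convex_convexHull ℝ D).closure ⟨0, hDK (Set.mem_insert _ _)⟩ hΦ (by
      rintro φ ⟨Y, hY, hφ⟩
      obtain ⟨c, hc⟩ := exists_ae_abs_le (hmem Y hY)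
      obtain ⟨n, hn⟩ := exists_nat_gt (c / r)
      rw [div_lt_iff₀ hr] at hn
      have hY2 : MemLp Y 2 P := (hmem Y hY).mono_exponent le_top
      have hyK : hY2.toLp Y ∈ K n := by
        refine ⟨hcongr _ _ hY hY2.coeFn_toLp, ?_⟩
        filter_upwards [hc, hY2.coeFn_toLp] with ω h1 h2
        rw [h2]
        nlinarith
      obtain ⟨f, hf, h1⟩ := hU n _ hyK
      refine ⟨toLpOne P f, hDK (Set.mem_insert_of_mem _ (Set.mem_iUnion.2 ⟨n, f, hf, rfl⟩)), ?_⟩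
      rw [hφ]
      have : ∫ ω, toLpOne P f ω * Y ω ∂P = ∫ ω, f ω * (hY2.toLp Y) ω ∂P :=
        integral_congr_ae (by
          filter_upwards [toLpOne_ae P f, hY2.coeFn_toLp] with ω h1 h2
          rw [h1, h2])
      rw [this]
      exact h1.le)
  refine ⟨h, L1.integrable_coeFn h, fun Y hY => ?_⟩
  let B : ℝ →L[ℝ] ℝ →L[ℝ] ℝ := ContinuousLinearMap.mul ℝ ℝ
  let φ : StrongDual ℝ (Lp ℝ 1 P) := B.lpPairing P ∞ 1 ((hmem Y hY).toLp Y)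
  have hφ : ∀ h', φ h' = ∫ ω, h' ω * Y ω ∂P := by
    intro h'
    simp only [φ, ContinuousLinearMap.lpPairing_eq_integral]
    refine integral_congr_ae ?_
    filter_upwards [(hmem Y hY).coeFn_toLp] with ω h1
    rw [h1]
    simp [B, mul_comm]
  rw [← hφ]
  exact hh φ ⟨Y, hY, hφ⟩

end

/-! ### Robust representation of the risk measure -/

section

variable {Ω : Type*} [MeasurableSpace Ω]

/-- A real number `a` dominates the penalty of `S`. -/
def PenaltyLE (P : Measure Ω) (ρ : (Ω → ℝ) → ℝ) (S : Measure Ω) (a : ℝ) : Prop :=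
  ∀ Y ∈ acceptanceSet P ρ, ∫ ω, -Y ω ∂S ≤ a

/-- The measure with density `q` with respect to `S`. -/
def densityMeasure (S : Measure Ω) (q : Ω → ℝ) : Measure Ω :=
  S.withDensity fun ω => ENNReal.ofReal (q ω)

theorem isProbabilityMeasure_densityMeasure {S : Measure Ω} {q : Ω → ℝ} (hq : Integrable q S)
    (h0 : 0 ≤ᵐ[S] q) (h1 : ∫ ω, q ω ∂S = 1) : IsProbabilityMeasure (densityMeasure S q) := by
  constructor
  rw [densityMeasure, withDensity_apply _ MeasurableSet.univ, Measure.restrict_univ,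
    ← ofReal_integral_eq_lintegral_ofReal hq h0, h1, ENNReal.ofReal_one]

theorem integral_densityMeasure {S : Measure Ω} {q : Ω → ℝ} (hq : Integrable q S)
    (h0 : 0 ≤ᵐ[S] q) (f : Ω → ℝ) : ∫ ω, f ω ∂(densityMeasure S q) = ∫ ω, q ω * f ω ∂S := by
  rw [densityMeasure, integral_withDensity_eq_integral_toReal_smul₀
    hq.aestronglyMeasurable.aemeasurable.ennreal_ofReal
    (ae_of_all _ fun _ => ENNReal.ofReal_lt_top)]
  refine integral_congr_ae ?_
  filter_upwards [h0] with ω h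
  rw [ENNReal.toReal_ofReal h, smul_eq_mul]

namespace IsConvexRiskMeasure

variable {P : Measure Ω} {ρ : (Ω → ℝ) → ℝ}

theorem congr (hρ : IsConvexRiskMeasure P ρ) {Y Y' : Ω → ℝ} (hY : MemLp Y ∞ P)
    (h : Y' =ᵐ[P] Y) : ρ Y' = ρ Y := by
  have hY' : MemLp Y' ∞ P := hY.ae_eq h.symm
  exact le_antisymm (hρ.monotone _ _ hY' hY h.symm.le) (hρ.monotone _ _ hY hY' h.le)

theorem const (hρ : IsConvexRiskMeasure P ρ) (y : ℝ) :
    ρ (fun _ => y) = ρ (fun _ => 0) - y := by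
  have := hρ.translative (fun _ => 0) y MemLp.zero
  simpa using this

theorem convex_comb (hρ : IsConvexRiskMeasure P ρ) {Y₁ Y₂ : Ω → ℝ} (h₁ : MemLp Y₁ ∞ P)
    (h₂ : MemLp Y₂ ∞ P) {a b : ℝ} (ha : 0 ≤ a) (hb : 0 ≤ b) (hab : a + b = 1) :
    ρ (fun ω => a * Y₁ ω + b * Y₂ ω) ≤ a * ρ Y₁ + b * ρ Y₂ := by
  obtain rfl : b = 1 - a := by linarith
  exact hρ.convex Y₁ Y₂ a h₁ h₂ ha (by linarith)

/-- The robust representation of convex risk measures with the Fatou property. -/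
theorem exists_lt_integral_sub [IsProbabilityMeasure P] (hρ : IsConvexRiskMeasure P ρ)
    {Y₀ : Ω → ℝ} (hY₀ : MemLp Y₀ ∞ P) {c : ℝ} (hc : c < ρ Y₀) :
    ∃ S ∈ acMeasures P, ∃ a, PenaltyLE P ρ S a ∧ c < ∫ ω, -Y₀ ω ∂S - a := by
  set Y₁ : Ω → ℝ := fun ω => Y₀ ω + c with hY₁def
  have hY₁ : MemLp Y₁ ∞ P := hY₀.add (memLp_const c)
  have hρY₁ : ρ Y₁ = ρ Y₀ - c := hρ.translative Y₀ c hY₀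
  -- `C` is the acceptance set translated by `-Y₁`. Since `ρ Y₁ = ρ Y₀ - c > 0`, it avoids the ball
  -- whose radius is half this gap.
  let C : Set (Ω → ℝ) := {Y | MemLp Y ∞ P ∧ ρ (fun ω => Y ω + Y₁ ω) ≤ 0}
  obtain ⟨h, hhint, hh⟩ := exists_integrable_forall_one_le_integral P (C := C)
    (r := (ρ Y₀ - c) / 2) (fun Y hY => hY.1)
    (by
      rintro Y Y' ⟨hY, hYρ⟩ hYY
      refine ⟨hY.ae_eq hYY.symm, ?_⟩
      rwa [hρ.congr (hY.add hY₁) (Y' := fun ω => Y' ω + Y₁ ω)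
        (by filter_upwards [hYY] with ω h; simp [h])])
    (by
      rintro Y ⟨hY, hYρ⟩ Z ⟨hZ, hZρ⟩ a b ha hb hab
      refine ⟨(hY.const_smul a).add (hZ.const_smul b), ?_⟩
      have := hρ.convex_comb (hY.add hY₁) (hZ.add hY₁) ha hb hab
      have e : (fun ω => (a • Y + b • Z) ω + Y₁ ω) =
          fun ω => a * (Y + Y₁) ω + b * (Z + Y₁) ω := by
        ext ω
        simp only [Pi.add_apply, Pi.smul_apply, smul_eq_mul]
        linear_combination (-Y₁ ω) * hab
      rw [e]
      have h1 : ρ (Y + Y₁) ≤ 0 := hYρ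
      have h2 : ρ (Z + Y₁) ≤ 0 := hZρ
      nlinarith)
    (by
      rintro Yn Y hYn hY ⟨b, hb⟩ hlim
      refine ⟨hY, ?_⟩
      obtain ⟨b', hb'⟩ := exists_ae_abs_le hY₁
      have := hρ.fatou (fun n ω => Yn n ω + Y₁ ω) (fun ω => Y ω + Y₁ ω)
        (fun n => (hYn n).1.add hY₁) (hY.add hY₁)
        ⟨b + b', fun n => by
          filter_upwards [hb n, hb'] with ω h1 h2
          exact (abs_add_le _ _).trans (add_le_add h1 h2)⟩
        (by filter_upwards [hlim] with ω h1; exact h1.add_const _)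
      have h2 : liminf (fun n => (ρ (fun ω => Yn n ω + Y₁ ω) : EReal)) atTop ≤ 0 := by
        refine (liminf_le_limsup).trans (limsup_le_of_le (h := Eventually.of_forall fun n => ?_))
        exact_mod_cast (hYn n).2
      exact_mod_cast this.trans h2)
    (by linarith)
    (by
      rintro Y ⟨hY, hYρ⟩ hle
      have h1 := hρ.monotone (fun ω => Y₁ ω + (ρ Y₀ - c) / 2) (fun ω => Y ω + Y₁ ω)
        (hY₁.add (memLp_const _)) (hY.add hY₁)
        (by filter_upwards [hle] with ω h; linarith [le_abs_self (Y ω)])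
      rw [hρ.translative _ _ hY₁] at h1
      linarith)
  have hmemC : ∀ Y ∈ acceptanceSet P ρ, (fun ω => Y ω - Y₁ ω) ∈ C := fun Y hY =>
    ⟨hY.1.sub hY₁, by simpa using hY.2⟩
  have hA : (fun _ : Ω => ρ fun _ => 0) ∈ acceptanceSet P ρ :=
    ⟨memLp_const _, by rw [hρ.const]; simp⟩
  -- `C` is stable under adding nonnegative positions. If `h` had negative integral over `B`, adding
  -- the multiple `t` of its indicator would bring the pairing down to zero, below the level one.
  have hpos : 0 ≤ᵐ[P] h := by
    refine ae_nonneg_of_forall_setIntegral_nonneg hhint fun B hB _ => ?_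
    by_contra hneg
    push Not at hneg
    obtain ⟨hYm, hYρ⟩ := hmemC _ hA
    set Y := fun ω => (ρ fun _ => 0) - Y₁ ω
    set t := (∫ ω, h ω * Y ω ∂P) / (-∫ ω in B, h ω ∂P) with ht
    have ht0 : 0 ≤ t := div_nonneg (zero_le_one.trans (hh Y ⟨hYm, hYρ⟩)) (by linarith)
    have hI : MemLp (B.indicator fun _ => t) ∞ P := (memLp_const t).indicator hB
    have hmem : (fun ω => Y ω + B.indicator (fun _ => t) ω) ∈ C := by
      refine ⟨hYm.add hI, le_trans (hρ.monotone _ _ ((hYm.add hI).add hY₁) (hYm.add hY₁) ?_) hYρ⟩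
      refine ae_of_all _ fun ω => ?_
      have : 0 ≤ B.indicator (fun _ => t) ω := Set.indicator_nonneg (fun _ _ => ht0) ω
      simp only [Pi.add_apply]
      linarith
    have h1 := hh _ hmem
    have e : ∫ ω, h ω * (Y ω + B.indicator (fun _ => t) ω) ∂P =
        ∫ ω, h ω * Y ω ∂P + (∫ ω in B, h ω ∂P) * t := by
      have iY : Integrable (fun ω => h ω * Y ω) P := hhint.mul_of_top_left hYm
      rw [← integral_mul_const, ← integral_indicator hB, ← integral_add iY
        ((hhint.mul_const t).indicator hB)]
      congr 1
      ext ω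
      by_cases hω : ω ∈ B
      · simp [hω, mul_add]
      · simp [hω]
    rw [e] at h1
    have h2 : t * (-∫ ω in B, h ω ∂P) = ∫ ω, h ω * Y ω ∂P := div_mul_cancel₀ _ (by linarith)
    linarith
  set κ := ∫ ω, h ω ∂P with hκ
  have hκpos : 0 < κ := by
    refine lt_of_le_of_ne (integral_nonneg_of_ae hpos) fun h0 => ?_
    have hz := (integral_eq_zero_iff_of_nonneg_ae hpos hhint).1 (by rw [← hκ, ← h0])
    have h1 := hh _ (hmemC _ hA)
    rw [integral_eq_zero_of_ae (by
      filter_upwards [hz] with ω hω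
      simp [hω])] at h1
    linarith
  set q : Ω → ℝ := fun ω => κ⁻¹ * h ω with hq
  have hqint : Integrable q P := hhint.const_mul _
  have hq0 : 0 ≤ᵐ[P] q := by
    filter_upwards [hpos] with ω hω
    exact mul_nonneg (inv_nonneg.2 hκpos.le) hω
  have hq1 : ∫ ω, q ω ∂P = 1 := by
    rw [hq, integral_const_mul, ← hκ, inv_mul_cancel₀ hκpos.ne']
  have hint : ∀ Y : Ω → ℝ, ∫ ω, Y ω ∂(densityMeasure P q) = κ⁻¹ * ∫ ω, h ω * Y ω ∂P := by
    intro Y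
    rw [integral_densityMeasure hqint hq0, ← integral_const_mul]
    simp only [hq, mul_assoc]
  -- After division by `κ`, the level one on `C` reads `κ⁻¹ ≤ E^S[Y - Y₁]` for acceptable `Y`; this
  -- fixes the penalty bound, and `κ⁻¹ > 0` makes the final inequality strict.
  refine ⟨densityMeasure P q, ⟨isProbabilityMeasure_densityMeasure hqint hq0 hq1,
    withDensity_absolutelyContinuous _ _⟩, ∫ ω, -Y₀ ω ∂(densityMeasure P q) - c - κ⁻¹, ?_, ?_⟩
  · intro Y hY
    have h1 := hh _ (hmemC Y hY)
    have i0 : Integrable (fun ω => h ω * Y₀ ω) P := hhint.mul_of_top_left hY₀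
    have iY : Integrable (fun ω => h ω * Y ω) P := hhint.mul_of_top_left hY.1
    have e : ∫ ω, h ω * (Y ω - Y₁ ω) ∂P =
        ∫ ω, h ω * Y ω ∂P - ∫ ω, h ω * Y₀ ω ∂P - κ * c := by
      have i1 : Integrable (fun ω => h ω * Y ω - h ω * Y₀ ω) P := iY.sub i0
      rw [hκ, ← integral_mul_const, ← integral_sub iY i0, ← integral_sub i1
        (hhint.mul_const c)]
      congr 1
      ext ω
      simp only [hY₁def]
      ring
    rw [e] at h1
    rw [integral_neg, integral_neg, hint, hint]
    have h2 : κ⁻¹ * 1 ≤ κ⁻¹ * (∫ ω, h ω * Y ω ∂P - ∫ ω, h ω * Y₀ ω ∂P - κ * c) :=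
      mul_le_mul_of_nonneg_left h1 (inv_nonneg.2 hκpos.le)
    have h3 : κ⁻¹ * (κ * c) = c := by rw [← mul_assoc, inv_mul_cancel₀ hκpos.ne', one_mul]
    linarith
  · have : 0 < κ⁻¹ := inv_pos.2 hκpos
    linarith

end IsConvexRiskMeasure

end

/-! ### Convex duality for finitely many outcomes -/

theorem IsAggregation.concaveOn {d : ℕ} {Λ : (Fin d → ℝ) → ℝ} (hΛ : IsAggregation Λ) :
    ConcaveOn ℝ Set.univ Λ := by
  refine ⟨convex_univ, fun x _ y _ a b ha hb hab => ?_⟩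
  obtain rfl : b = 1 - a := by linarith
  exact hΛ.concave x y a ha (by linarith)

theorem IsAggregation.continuous {d : ℕ} {Λ : (Fin d → ℝ) → ℝ} (hΛ : IsAggregation Λ) :
    Continuous Λ := hΛ.concaveOn.locallyLipschitz.continuous

theorem eq_zero_of_forall_le_dotProduct {ι : Type*} [Fintype ι] {a : ι → ℝ} {k : ℝ}
    (h : ∀ z, k ≤ a ⬝ᵥ z) : a = 0 := by
  by_contra ha
  have hpos : 0 < a ⬝ᵥ a :=
    lt_of_le_of_ne (Finset.sum_nonneg fun i _ => mul_self_nonneg (a i))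
      (Ne.symm (mt dotProduct_self_eq_zero.1 ha))
  have := h (((k - 1) / (a ⬝ᵥ a)) • a)
  rw [dotProduct_smul, smul_eq_mul, div_mul_cancel₀ _ hpos.ne'] at this
  linarith

/-- A lower bound for a separable sum splits into lower bounds for the summands. -/
theorem exists_forall_le_and_le_sum {J U : Type*} [Fintype J] [Nonempty U] {f : J → U → ℝ}
    {k : ℝ} (h : ∀ u : J → U, k ≤ ∑ j, f j (u j)) :
    ∃ γ : J → ℝ, (∀ j u, γ j ≤ f j u) ∧ k ≤ ∑ j, γ j := by
  classical
  obtain ⟨u₀⟩ := ‹Nonempty U›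
  have hbdd : ∀ j, BddBelow (Set.range (f j)) := by
    intro j
    refine ⟨k - ∑ i ∈ Finset.univ.erase j, f i u₀, ?_⟩
    rintro _ ⟨u, rfl⟩
    have := h (Function.update (fun _ => u₀) j u)
    rw [← Finset.add_sum_erase _ _ (Finset.mem_univ j), Function.update_self,
      Finset.sum_congr rfl fun i hi => by
        rw [Function.update_of_ne (Finset.ne_of_mem_erase hi)]] at this
    linarith
  refine ⟨fun j => ⨅ u, f j u, fun j u => ciInf_le (hbdd j) u, ?_⟩
  refine le_of_forall_pos_le_add fun ε hε => ?_
  have : ∀ j, ∃ u, f j u < (⨅ u, f j u) + ε / (Fintype.card J + 1) := fun j =>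
    haveI : Nonempty U := ⟨u₀⟩
    exists_lt_of_ciInf_lt (lt_add_of_pos_right _ (by positivity))
  choose u hu using this
  calc k ≤ ∑ j, f j (u j) := h u
    _ ≤ ∑ j, ((⨅ u, f j u) + ε / (Fintype.card J + 1)) := Finset.sum_le_sum fun j _ => (hu j).le
    _ = ∑ j, (⨅ u, f j u) + Fintype.card J * (ε / (Fintype.card J + 1)) := by
      rw [Finset.sum_add_distrib]; simp
    _ ≤ ∑ j, (⨅ u, f j u) + ε := by
      gcongr
      rw [mul_div_assoc', div_le_iff₀ (by positivity)]
      nlinarith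

/-- Convex duality for a monetary functional of finitely many outcomes composed with an
aggregation function, relative to the shifts by constants. -/
theorem IsAggregation.exists_dual {J : Type*} [Fintype J] {d : ℕ} {Λ : (Fin d → ℝ) → ℝ}
    (hΛ : IsAggregation Λ) {Φ : (J → ℝ) → ℝ} (hΦ : ConvexOn ℝ Set.univ Φ)
    (htrans : ∀ y r, Φ (fun j => y j + r) = Φ y - r)
    {x : J → Fin d → ℝ} {v : Fin d → ℝ} {c : ℝ}
    (hmono : ∀ y y', y ≤ y' → Φ y' ≤ Φ y)
    (h : ∀ z, c - v ⬝ᵥ z ≤ Φ fun j => Λ (x j + z)) :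
    ∃ (s : J → ℝ) (b : ℝ) (ζ : J → Fin d → ℝ) (γ : J → ℝ), (∀ j, 0 ≤ s j) ∧ ∑ j, s j = 1 ∧
      (∀ y : J → ℝ, -∑ j, s j * y j - b ≤ Φ y) ∧ (∀ j u, s j * Λ u ≤ ζ j ⬝ᵥ u + γ j) ∧
      ∑ j, ζ j = v ∧ b + ∑ j, γ j + ∑ j, ζ j ⬝ᵥ x j ≤ -c := by
  classical
  -- First sandwich: linearise `Φ` above the attainable pairs. The set is closed downward in the
  -- outcome, which forces `s ≥ 0`; translation by constants forces total weight one.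
  obtain ⟨f, b, hf1, hf2⟩ := exists_affine_between hΦ hΦ.locallyLipschitz.continuous
    (K := {p : (J → ℝ) × ℝ | ∃ z, (∀ j, p.1 j ≤ Λ (x j + z)) ∧ p.2 ≤ c - v ⬝ᵥ z})
    (by
      rintro ⟨y₁, t₁⟩ ⟨z₁, hy₁, ht₁⟩ ⟨y₂, t₂⟩ ⟨z₂, hy₂, ht₂⟩ a a' ha ha' haa
      refine ⟨a • z₁ + a' • z₂, fun j => ?_, ?_⟩
      · have e : x j + (a • z₁ + a' • z₂) = a • (x j + z₁) + a' • (x j + z₂) := by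
          rw [smul_add, smul_add, add_add_add_comm, ← add_smul, haa, one_smul]
        rw [e]
        refine le_trans ?_ (hΛ.concaveOn.2 trivial trivial ha ha' haa)
        have h1 := mul_le_mul_of_nonneg_left (hy₁ j) ha
        have h2 := mul_le_mul_of_nonneg_left (hy₂ j) ha'
        exact add_le_add h1 h2
      · simp only [Prod.snd_add, Prod.smul_snd, smul_eq_mul, dotProduct_add, dotProduct_smul]
        have h1 := mul_le_mul_of_nonneg_left ht₁ ha
        have h2 := mul_le_mul_of_nonneg_left ht₂ ha'
        simp only at h1 h2
        linear_combination h1 + h2 + c * haa)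
    ⟨(fun j => Λ (x j + 0), c - v ⬝ᵥ 0), 0, fun j => le_rfl, le_rfl⟩
    (by
      rintro ⟨y, t⟩ ⟨z, hy, ht⟩
      exact ht.trans ((h z).trans (hmono _ _ hy)))
  set s : J → ℝ := fun j => -f (Pi.single j 1) with hs
  have hfs : ∀ y, f y = -∑ j, s j * y j := by
    intro y
    conv_lhs => rw [← Finset.univ_sum_single y]
    rw [map_sum, ← Finset.sum_neg_distrib]
    refine Finset.sum_congr rfl fun j _ => ?_
    have : (Pi.single j (y j) : J → ℝ) = y j • Pi.single j 1 := by
      rw [← Pi.single_smul]; simp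
    rw [this, map_smul, smul_eq_mul, hs]
    ring
  have hs0 : ∀ j, 0 ≤ s j := by
    intro j
    by_contra hneg
    push Not at hneg
    let Y : J → ℝ := fun j => Λ (x j + 0)
    set t : ℝ := (|f Y - b - c| + 1) / (-s j) with ht
    have ht0 : 0 ≤ t := div_nonneg (by positivity) (by linarith)
    have h1 := hf2 (Y - Pi.single j t, c) ⟨0, fun i => ?_, by simp⟩
    · simp only [map_sub] at h1
      have h2 : f (Pi.single j t) = -s j * t := by
        have : (Pi.single j t : J → ℝ) = t • Pi.single j 1 := by
          rw [← Pi.single_smul]; simp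
        rw [this, map_smul, smul_eq_mul, hs]
        ring
      have h3 : t * (-s j) = |f Y - b - c| + 1 := div_mul_cancel₀ _ (by linarith)
      rw [h2] at h1
      linarith [le_abs_self (f Y - b - c)]
    · have : 0 ≤ (Pi.single j t : J → ℝ) i := by
        by_cases hij : i = j
        · subst hij; simpa using ht0
        · simp [hij]
      simp only [Pi.sub_apply, Y]
      linarith
  have hs1 : ∑ j, s j = 1 := by
    have h0 : ∀ r : ℝ, -r * ∑ j, s j - b ≤ Φ 0 - r := by
      intro r
      have h1 := hf1 fun j => (0 : J → ℝ) j + r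
      rw [htrans 0 r, hfs] at h1
      simp only [Pi.zero_apply, zero_add, ← Finset.sum_mul] at h1
      linarith
    have h2 : (fun _ : Unit => (∑ j, s j) - 1) = 0 := by
      refine eq_zero_of_forall_le_dotProduct (k := -b - Φ 0) fun z => ?_
      have := h0 (z ())
      simp only [dotProduct, Finset.univ_unique, Finset.sum_singleton]
      change -b - Φ 0 ≤ ((∑ j, s j) - 1) * z ()
      linarith
    have := congrFun h2 ()
    simp only [Pi.zero_apply] at this
    linarith
  have hFconv : ConvexOn ℝ Set.univ fun u : J → Fin d → ℝ => -∑ j, s j * Λ (u j) := by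
    refine ⟨convex_univ, fun u _ u' _ a a' ha ha' haa => ?_⟩
    simp only [smul_eq_mul, mul_neg, Finset.mul_sum]
    rw [← neg_add, ← Finset.sum_add_distrib, neg_le_neg_iff]
    refine Finset.sum_le_sum fun j _ => ?_
    have h1 := mul_le_mul_of_nonneg_left
      (hΛ.concaveOn.2 (Set.mem_univ (u j)) (Set.mem_univ (u' j)) ha ha' haa) (hs0 j)
    simp only [smul_eq_mul] at h1
    calc a * (s j * Λ (u j)) + a' * (s j * Λ (u' j))
        = s j * (a * Λ (u j) + a' * Λ (u' j)) := by ring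
      _ ≤ _ := h1
  have hFcont : Continuous fun u : J → Fin d → ℝ => -∑ j, s j * Λ (u j) := by
    refine (continuous_finsetSum _ fun j _ => ?_).neg
    exact continuous_const.mul (hΛ.continuous.comp (continuous_apply j))
  -- Second sandwich: linearise the `s`-weighted aggregation in independent arguments `u j` along
  -- the common shifts `x j + z`. The two sides are affine in `z`, so their slopes agree, which
  -- gives `∑ j, ζ j = v`.
  obtain ⟨g, b₂, hg1, hg2⟩ := exists_affine_between hFconv hFcont
    (K := Set.range fun z : Fin d → ℝ => ((fun j => x j + z, c + b - v ⬝ᵥ z) :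
      (J → Fin d → ℝ) × ℝ))
    (by
      rintro _ ⟨z₁, rfl⟩ _ ⟨z₂, rfl⟩ a a' ha ha' haa
      refine ⟨a • z₁ + a' • z₂, Prod.ext ?_ ?_⟩
      · ext j : 1
        simp only [Prod.smul_mk, Prod.mk_add_mk, Pi.add_apply, Pi.smul_apply]
        rw [smul_add, smul_add, add_add_add_comm, ← add_smul, haa, one_smul]
      · simp only [Prod.smul_mk, Prod.mk_add_mk, smul_eq_mul, dotProduct_add, dotProduct_smul]
        linear_combination (-(c + b)) * haa)
    (Set.range_nonempty _)
    (by
      rintro _ ⟨z, rfl⟩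
      have := hf2 (fun j => Λ (x j + z), c - v ⬝ᵥ z) ⟨z, fun j => le_rfl, le_rfl⟩
      rw [hfs] at this
      simp only at this ⊢
      linarith)
  set ζ : J → Fin d → ℝ := fun j i => -g (Pi.single j (Pi.single i 1)) with hζ
  have hgζ : ∀ u, g u = -∑ j, ζ j ⬝ᵥ u j := by
    intro u
    conv_lhs => rw [← Finset.univ_sum_single u]
    rw [map_sum, ← Finset.sum_neg_distrib]
    refine Finset.sum_congr rfl fun j _ => ?_
    have : (Pi.single j (u j) : J → Fin d → ℝ) = ∑ i, u j i • Pi.single j (Pi.single i 1) := by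
      simp_rw [← Pi.single_smul, smul_eq_mul, mul_one]
      conv_lhs => rw [← Finset.univ_sum_single (u j)]
      exact map_sum (AddMonoidHom.single (fun _ : J => Fin d → ℝ) j) _ _
    rw [this, map_sum, dotProduct, ← Finset.sum_neg_distrib]
    refine Finset.sum_congr rfl fun i _ => ?_
    rw [map_smul, smul_eq_mul, hζ]
    ring
  have hζz : ∀ z, c + b - v ⬝ᵥ z ≤ -∑ j, ζ j ⬝ᵥ x j - (∑ j, ζ j) ⬝ᵥ z - b₂ := by
    intro z
    have := hg2 _ ⟨z, rfl⟩
    rw [hgζ] at this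
    simp only [dotProduct_add, Finset.sum_add_distrib] at this
    rw [sum_dotProduct]
    linarith
  have hζv : ∑ j, ζ j = v := by
    have : v - ∑ j, ζ j = 0 := by
      refine eq_zero_of_forall_le_dotProduct (k := c + b + ∑ j, ζ j ⬝ᵥ x j + b₂) fun z => ?_
      rw [sub_dotProduct]
      linarith [hζz z]
    exact (sub_eq_zero.1 this).symm
  obtain ⟨γ, hγ1, hγ2⟩ := exists_forall_le_and_le_sum
    (f := fun j (u : Fin d → ℝ) => ζ j ⬝ᵥ u - s j * Λ u) (k := -b₂) fun u => by
      have := hg1 u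
      rw [hgζ] at this
      rw [Finset.sum_sub_distrib]
      linarith
  refine ⟨s, b, ζ, fun j => -γ j, hs0, hs1, fun y => ?_, fun j u => ?_, hζv, ?_⟩
  · rw [← hfs]
    exact hf1 y
  · linarith [hγ1 j u]
  · have := hζz 0
    simp only [dotProduct_zero, sub_zero] at this
    rw [Finset.sum_neg_distrib]
    linarith

/-! ### Mixtures of measures and finite partitions -/

section

variable {Ω : Type*} [MeasurableSpace Ω]

theorem memLp_top_of_absolutelyContinuous {P S : Measure Ω} (hS : S ≪ P) {Y : Ω → ℝ}
    (hY : MemLp Y ∞ P) : MemLp Y ∞ S := by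
  obtain ⟨c, hc⟩ := exists_ae_abs_le hY
  exact memLp_top_of_bound (hY.1.mono_ac hS) c (hS.ae_le hc)

theorem integrable_of_memLp_top {P S : Measure Ω} [IsFiniteMeasure S] (hS : S ≪ P) {Y : Ω → ℝ}
    (hY : MemLp Y ∞ P) : Integrable Y S :=
  (memLp_top_of_absolutelyContinuous hS hY).integrable le_top

/-- The convex combination `(1 - a) S₁ + a S₂`. -/
def mixMeasure (a : ℝ) (S₁ S₂ : Measure Ω) : Measure Ω :=
  ENNReal.ofReal (1 - a) • S₁ + ENNReal.ofReal a • S₂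

section mix

variable {P S₁ S₂ : Measure Ω} {a : ℝ}

theorem mixMeasure_mem (h₁ : S₁ ∈ acMeasures P) (h₂ : S₂ ∈ acMeasures P) (ha : 0 ≤ a)
    (ha1 : a ≤ 1) : mixMeasure a S₁ S₂ ∈ acMeasures P := by
  have := h₁.1
  have := h₂.1
  refine ⟨⟨?_⟩, ?_⟩
  · simp only [mixMeasure, Measure.add_apply, Measure.smul_apply, measure_univ, smul_eq_mul,
      mul_one]
    rw [← ENNReal.ofReal_add (by linarith) ha]
    simp
  · refine Measure.AbsolutelyContinuous.add_left ?_ ?_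
    · exact Measure.smul_absolutelyContinuous.trans h₁.2
    · exact Measure.smul_absolutelyContinuous.trans h₂.2

/-- Any positive share of an equivalent measure already dominates `P`; this is how the dual measures
are made equivalent at small cost. -/
theorem mixMeasure_mem_equiv (h₁ : S₁ ∈ acMeasures P) (h₂ : S₂ ∈ equivMeasures P) (ha : 0 < a)
    (ha1 : a ≤ 1) : mixMeasure a S₁ S₂ ∈ equivMeasures P := by
  have h := mixMeasure_mem h₁ (⟨h₂.1, h₂.2.1⟩ : S₂ ∈ acMeasures P) ha.le ha1
  refine ⟨h.1, h.2, h₂.2.2.trans ?_⟩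
  refine (Measure.absolutelyContinuous_smul (c := ENNReal.ofReal a) ?_).trans
    (Measure.le_add_left le_rfl).absolutelyContinuous
  simpa using ha

theorem integral_mixMeasure {f : Ω → ℝ} (h₁ : Integrable f S₁) (h₂ : Integrable f S₂)
    (ha : 0 ≤ a) (ha1 : a ≤ 1) :
    ∫ ω, f ω ∂(mixMeasure a S₁ S₂) = (1 - a) * ∫ ω, f ω ∂S₁ + a * ∫ ω, f ω ∂S₂ := by
  rw [mixMeasure, integral_add_measure (h₁.smul_measure ENNReal.ofReal_ne_top)
    (h₂.smul_measure ENNReal.ofReal_ne_top), integral_smul_measure, integral_smul_measure,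
    ENNReal.toReal_ofReal (by linarith), ENNReal.toReal_ofReal ha, smul_eq_mul, smul_eq_mul]

theorem real_mixMeasure [IsFiniteMeasure S₁] [IsFiniteMeasure S₂] (ha : 0 ≤ a) (ha1 : a ≤ 1)
    (B : Set Ω) : (mixMeasure a S₁ S₂).real B = (1 - a) * S₁.real B + a * S₂.real B := by
  simp only [Measure.real, mixMeasure, Measure.add_apply, Measure.smul_apply, smul_eq_mul]
  rw [ENNReal.toReal_add (ENNReal.mul_ne_top ENNReal.ofReal_ne_top (measure_ne_top _ _))
    (ENNReal.mul_ne_top ENNReal.ofReal_ne_top (measure_ne_top _ _)), ENNReal.toReal_mul,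
    ENNReal.toReal_mul, ENNReal.toReal_ofReal (by linarith), ENNReal.toReal_ofReal ha]

theorem penaltyLE_mixMeasure {ρ : (Ω → ℝ) → ℝ} (h₁ : S₁ ∈ acMeasures P)
    (h₂ : S₂ ∈ acMeasures P) (ha : 0 ≤ a) (ha1 : a ≤ 1) {c₁ c₂ : ℝ} (hc₁ : PenaltyLE P ρ S₁ c₁)
    (hc₂ : PenaltyLE P ρ S₂ c₂) : PenaltyLE P ρ (mixMeasure a S₁ S₂) ((1 - a) * c₁ + a * c₂) := by
  have := h₁.1
  have := h₂.1
  intro Y hY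
  have i₁ : Integrable (fun ω => -Y ω) S₁ := (integrable_of_memLp_top h₁.2 hY.1).neg
  have i₂ : Integrable (fun ω => -Y ω) S₂ := (integrable_of_memLp_top h₂.2 hY.1).neg
  rw [integral_mixMeasure i₁ i₂ ha ha1]
  have e₁ := mul_le_mul_of_nonneg_left (hc₁ Y hY) (by linarith : 0 ≤ 1 - a)
  have e₂ := mul_le_mul_of_nonneg_left (hc₂ Y hY) ha
  linarith

end mix

section finite

variable {J : Type*} [Fintype J] [MeasurableSpace J] [MeasurableSingletonClass J] {ξ : Ω → J}

theorem memLp_comp_finite {P : Measure Ω} (hξ : Measurable ξ) (y : J → ℝ) :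
    MemLp (fun ω => y (ξ ω)) ∞ P := by
  refine memLp_top_of_bound ((measurable_of_finite y).comp hξ).aestronglyMeasurable ‖y‖
    (ae_of_all _ fun ω => norm_le_pi_norm y _)

theorem integral_comp_finite (S : Measure Ω) [IsFiniteMeasure S] (hξ : Measurable ξ)
    (y : J → ℝ) : ∫ ω, y (ξ ω) ∂S = ∑ j, S.real (ξ ⁻¹' {j}) * y j := by
  rw [← integral_map hξ.aemeasurable (f := y) (measurable_of_finite y).aestronglyMeasurable,
    integral_fintype Integrable.of_finite]
  refine Finset.sum_congr rfl fun j _ => ?_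
  rw [map_measureReal_apply hξ (measurableSet_singleton j), smul_eq_mul]

theorem sum_real_preimage_singleton (S : Measure Ω) [IsProbabilityMeasure S] (hξ : Measurable ξ) :
    ∑ j, S.real (ξ ⁻¹' {j}) = 1 := by
  have := integral_comp_finite S hξ fun _ => 1
  simpa using this.symm

/-- The constant `ρ 0` has risk zero, so it is an admissible test position. The resulting lower
bound is uniform in `S`. -/
theorem PenaltyLE.neg_rho_zero_le {P S : Measure Ω} [IsProbabilityMeasure P]
    [IsProbabilityMeasure S] {ρ : (Ω → ℝ) → ℝ} (hρ : IsConvexRiskMeasure P ρ) {a : ℝ}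
    (h : PenaltyLE P ρ S a) : -(ρ fun _ => 0) ≤ a := by
  have := h (fun _ => ρ fun _ => 0) ⟨memLp_const _, by rw [hρ.const]; simp⟩
  simpa using this

/-- An affine minorant of a convex risk measure on a finite partition is approximated by the
values of probability measures on the partition, with almost the same penalty. -/
theorem IsConvexRiskMeasure.exists_approx {P : Measure Ω} [IsProbabilityMeasure P]
    {ρ : (Ω → ℝ) → ℝ} (hρ : IsConvexRiskMeasure P ρ) (hξ : Measurable ξ) {s : J → ℝ} {b : ℝ}
    (h : ∀ y : J → ℝ, -∑ j, s j * y j - b ≤ ρ fun ω => y (ξ ω)) {ε : ℝ} (hε : 0 < ε) :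
    ∃ S ∈ acMeasures P, PenaltyLE P ρ S (b + ε) ∧ ∀ j, |S.real (ξ ⁻¹' {j}) - s j| < ε := by
  classical
  by_contra hcon
  push Not at hcon
  let T : Set ((J → ℝ) × ℝ) := {p | ∃ S ∈ acMeasures P, PenaltyLE P ρ S p.2 ∧
    ∀ j, p.1 j = S.real (ξ ⁻¹' {j})}
  have hT : Convex ℝ T := by
    rintro p ⟨S₁, h₁, hp₁, he₁⟩ q ⟨S₂, h₂, hp₂, he₂⟩ a' a ha' ha haa
    obtain rfl : a' = 1 - a := by linarith
    have := h₁.1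
    have := h₂.1
    have ha1 : a ≤ 1 := by linarith
    refine ⟨mixMeasure a S₁ S₂, mixMeasure_mem h₁ h₂ ha ha1,
      penaltyLE_mixMeasure h₁ h₂ ha ha1 hp₁ hp₂, fun j => ?_⟩
    rw [real_mixMeasure ha ha1, ← he₁, ← he₂]
    rfl
  let U : Set ((J → ℝ) × ℝ) := Metric.ball s ε ×ˢ Set.Iio (b + ε)
  have hU : Convex ℝ U := (convex_ball s ε).prod (convex_Iio _)
  have hUo : IsOpen U := Metric.isOpen_ball.prod isOpen_Iio
  have hdisj : Disjoint U T := by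
    rw [Set.disjoint_left]
    rintro ⟨y, t⟩ ⟨hy, ht⟩ ⟨S, hS, hp, he⟩
    obtain ⟨j, hj⟩ := hcon S hS fun Y hY => (hp Y hY).trans (le_of_lt ht)
    rw [mem_ball_iff_norm, pi_norm_lt_iff hε] at hy
    have := hy j
    simp only [Pi.sub_apply, Real.norm_eq_abs] at this
    rw [show y j = _ from he j] at this
    exact absurd this (not_lt.2 hj)
  obtain ⟨g, κ, hg1, hg2⟩ := geometric_hahn_banach_open hU hUo hT hdisj
  set y : J → ℝ := fun j => g (Pi.single j 1, 0) with hy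
  set τ : ℝ := g (0, 1) with hτ
  have hg : ∀ u t, g (u, t) = ∑ j, u j * y j + τ * t := by
    intro u t
    have e : ((u, t) : (J → ℝ) × ℝ) = ∑ j, u j • ((Pi.single j 1, 0) : (J → ℝ) × ℝ) +
        t • (0, 1) := by
      refine Prod.ext ?_ ?_
      · ext i
        simp [Prod.fst_sum, Finset.sum_apply, Pi.single_apply]
      · simp [Prod.snd_sum]
    rw [e, map_add, map_sum, map_smul, smul_eq_mul, mul_comm t]
    simp only [map_smul, smul_eq_mul, hy, hτ]
  have hU1 : ∀ t < b + ε, ∑ j, s j * y j + τ * t < κ := fun t ht => by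
    rw [← hg]
    exact hg1 _ ⟨Metric.mem_ball_self hε, ht⟩
  have hT1 : ∀ S ∈ acMeasures P, ∀ a, PenaltyLE P ρ S a →
      κ ≤ ∑ j, S.real (ξ ⁻¹' {j}) * y j + τ * a := fun S hS a ha => by
    rw [← hg]
    exact hg2 _ ⟨S, hS, ha, fun j => rfl⟩
  -- The robust representation at the position `N * y`, where `y` is the separating direction,
  -- combined with the affine minorant.
  have hN : ∀ N η : ℝ, 0 < η → ∃ S ∈ acMeasures P, ∃ a, PenaltyLE P ρ S a ∧
      a + N * ∑ j, S.real (ξ ⁻¹' {j}) * y j < N * ∑ j, s j * y j + b + η := by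
    intro N η hη
    obtain ⟨S, hS, a, ha, hlt⟩ := hρ.exists_lt_integral_sub
      (memLp_comp_finite hξ fun j => N * y j) (c := -(N * ∑ j, s j * y j) - b - η) (by
        have := h fun j => N * y j
        have e : ∑ j, s j * (N * y j) = N * ∑ j, s j * y j := by
          rw [Finset.mul_sum]
          exact Finset.sum_congr rfl fun j _ => by ring
        rw [e] at this
        linarith)
    refine ⟨S, hS, a, ha, ?_⟩
    have := hS.1
    rw [integral_neg, integral_comp_finite S hξ fun j => N * y j] at hlt
    have e : ∑ j, S.real (ξ ⁻¹' {j}) * (N * y j) = N * ∑ j, S.real (ξ ⁻¹' {j}) * y j := by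
      rw [Finset.mul_sum]
      exact Finset.sum_congr rfl fun j _ => by ring
    rw [e] at hlt
    linarith
  obtain ⟨S₀, hS₀, a₀, ha₀, -⟩ := hN 0 1 one_pos
  have hτ0 : 0 ≤ τ := by
    by_contra hneg
    push Not at hneg
    set t := min b ((κ - ∑ j, s j * y j) / τ)
    have h1 := hU1 t (by linarith [min_le_left b ((κ - ∑ j, s j * y j) / τ)])
    have h2 : τ * ((κ - ∑ j, s j * y j) / τ) ≤ τ * t :=
      mul_le_mul_of_nonpos_left (min_le_right _ _) hneg.le
    rw [mul_div_cancel₀ _ hneg.ne] at h2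
    linarith
  have hlt := hU1 (b + ε / 2) (by linarith)
  rcases hτ0.eq_or_lt with h0 | hpos
  -- Vertical separation: the cell probabilities stay a fixed distance from `s` in direction `y`, so
  -- a large `N` would push the penalty bound below `-ρ 0`.
  · rw [← h0, zero_mul, add_zero] at hlt
    set N := (|b| + 1 + |ρ fun _ => 0|) / (κ - ∑ j, s j * y j) with hNdef
    have hN0 : 0 ≤ N := div_nonneg (by positivity) (by linarith)
    obtain ⟨S, hS, a, ha, h1⟩ := hN N 1 one_pos
    have := hS.1
    have h2 := hT1 S hS a ha
    rw [← h0, zero_mul, add_zero] at h2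
    have h3 := ha.neg_rho_zero_le hρ
    have h4 : N * (κ - ∑ j, s j * y j) = |b| + 1 + |ρ fun _ => 0| :=
      div_mul_cancel₀ _ (by linarith)
    have h5 := mul_le_mul_of_nonneg_left h2 hN0
    linarith [le_abs_self b, le_abs_self (ρ fun _ => 0)]
  -- The multiple `τ⁻¹` matches the relative weight of `y` and the penalty in the separating
  -- functional.
  · obtain ⟨S, hS, a, ha, h1⟩ := hN τ⁻¹ (ε / 2) (by linarith)
    have h2 := hT1 S hS a ha
    have h3 := mul_lt_mul_of_pos_left h1 hpos
    have e1 : ∀ r : ℝ, τ * (τ⁻¹ * r) = r := fun r => by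
      rw [← mul_assoc, mul_inv_cancel₀ hpos.ne', one_mul]
    simp only [mul_add, e1] at h3 hlt
    linarith

end finite

end

/-! ### Weak duality and finite approximation -/

section

variable {Ω : Type*} [MeasurableSpace Ω]

theorem extExpectation_mono {S : Measure Ω} {f g : Ω → EReal} (h : f ≤ᵐ[S] g) :
    extExpectation S f ≤ extExpectation S g := by
  refine EReal.sub_le_sub ?_ ?_
  · exact EReal.coe_ennreal_le_coe_ennreal_iff.2 (lintegral_mono_ae
      (by filter_upwards [h] with ω h; exact EReal.toENNReal_le_toENNReal h))
  · exact EReal.coe_ennreal_le_coe_ennreal_iff.2 (lintegral_mono_ae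
      (by filter_upwards [h] with ω h
          exact EReal.toENNReal_le_toENNReal (EReal.neg_le_neg_iff.2 h)))

theorem extExpectation_coe {S : Measure Ω} {f : Ω → ℝ} (hf : Integrable f S) :
    extExpectation S (fun ω => (f ω : EReal)) = ((∫ ω, f ω ∂S : ℝ) : EReal) := by
  have h1 : ∫⁻ ω, ENNReal.ofReal (f ω) ∂S ≠ ∞ := hf.lintegral_lt_top.ne
  have h2 : ∫⁻ ω, ENNReal.ofReal (-f ω) ∂S ≠ ∞ := hf.neg.lintegral_lt_top.ne
  rw [integral_eq_lintegral_pos_part_sub_lintegral_neg_part hf, EReal.coe_sub,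
    EReal.coe_ennreal_toReal h1, EReal.coe_ennreal_toReal h2, extExpectation]
  rfl

theorem IsAggregation.memLp_comp {P : Measure Ω} {d : ℕ} {Λ : (Fin d → ℝ) → ℝ}
    (hΛ : IsAggregation Λ) {X : Ω → Fin d → ℝ} (hX : MemLp X ∞ P) :
    MemLp (fun ω => Λ (X ω)) ∞ P := by
  obtain ⟨c, hc⟩ := exists_ae_abs_le hX.norm
  obtain ⟨C, hC⟩ := ((isCompact_closedBall (0 : Fin d → ℝ) c).image hΛ.continuous).isBounded
    |>.exists_norm_le
  refine memLp_top_of_bound (hΛ.continuous.comp_aestronglyMeasurable hX.1) C ?_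
  filter_upwards [hc] with ω h
  refine hC _ ⟨X ω, ?_, rfl⟩
  simpa using h

theorem memLp_apply {P : Measure Ω} {d : ℕ} {X : Ω → Fin d → ℝ} (hX : MemLp X ∞ P) (i : Fin d) :
    MemLp (fun ω => X ω i) ∞ P :=
  hX.norm.mono ((continuous_apply i).comp_aestronglyMeasurable hX.1)
    (ae_of_all _ fun ω => by rw [norm_norm]; exact norm_le_pi_norm (X ω) i)

theorem integral_eq_integral_rnDeriv_mul {P Q S : Measure Ω} (hQ : Q ∈ acMeasures P)
    (hS : S ∈ equivMeasures P) (f : Ω → ℝ) :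
    ∫ ω, f ω ∂Q = ∫ ω, (Q.rnDeriv S ω).toReal * f ω ∂S := by
  have := hQ.1
  have := hS.1
  rw [← integral_rnDeriv_smul (hQ.2.trans hS.2.2)]
  rfl

/-- Weak duality for the insensitive systemic risk measure. -/
theorem weightedLoss_sub_rhoIns_le {P : Measure Ω} [IsProbabilityMeasure P]
    {ρ : (Ω → ℝ) → ℝ} (hρ : IsConvexRiskMeasure P ρ) {d : ℕ} {Λ : (Fin d → ℝ) → ℝ}
    (hΛ : IsAggregation Λ) {X : Ω → Fin d → ℝ} (hX : MemLp X ∞ P) {Q : Fin d → Measure Ω}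
    (hQ : Q ∈ vectorMeasures P d) (w : Fin d → ℝ) :
    ((weightedLoss Q w X - rhoIns ρ Λ X : ℝ) : EReal) ≤ sysPenalty P ρ Λ Q w := by
  refine le_iInf₂ fun S hS => ?_
  have := hS.1
  have hLX := hΛ.memLp_comp hX
  have iL : Integrable (fun ω => Λ (X ω)) S := integrable_of_memLp_top hS.2.1 hLX
  have iX : ∀ i, Integrable (fun ω => w i * ((Q i).rnDeriv S ω).toReal * X ω i) S := fun i => by
    have := (hQ i).1
    exact (Measure.integrable_toReal_rnDeriv.const_mul _).mul_of_top_left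
      (memLp_top_of_absolutelyContinuous hS.2.1 (memLp_apply hX i))
  have iS : Integrable (fun ω => ∑ i, w i * ((Q i).rnDeriv S ω).toReal * X ω i) S :=
    integrable_finsetSum _ fun i _ => iX i
  have h1 : ((∫ ω, -Λ (X ω) ∂S - rhoIns ρ Λ X : ℝ) : EReal) ≤ penalty P ρ S := by
    refine le_iSup₂_of_le (fun ω => Λ (X ω) + rhoIns ρ Λ X)
      ⟨hLX.add (memLp_const _), by rw [hρ.translative _ _ hLX, rhoIns]; simp⟩ ?_
    simp only [neg_add]
    have i1 : Integrable (fun ω => -Λ (X ω)) S := iL.neg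
    rw [integral_add i1 (integrable_const _)]
    simp [sub_eq_add_neg]
  have h2 : ((∫ ω, (Λ (X ω) - ∑ i, w i * ((Q i).rnDeriv S ω).toReal * X ω i) ∂S : ℝ) : EReal) ≤
      divergence Λ Q w S := by
    have i2 : Integrable
        (fun ω => Λ (X ω) - ∑ i, w i * ((Q i).rnDeriv S ω).toReal * X ω i) S := iL.sub iS
    rw [← extExpectation_coe i2]
    refine extExpectation_mono (ae_of_all _ fun ω => ?_)
    exact le_iSup_of_le (X ω) le_rfl
  refine le_trans (le_of_eq ?_) (add_le_add h1 h2)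
  rw [← EReal.coe_add, EReal.coe_eq_coe_iff, integral_sub iL iS, integral_neg,
    integral_finsetSum _ fun i _ => iX i, weightedLoss]
  have : ∑ i, w i * ∫ ω, -X ω i ∂(Q i) =
      -∑ i, ∫ ω, w i * ((Q i).rnDeriv S ω).toReal * X ω i ∂S := by
    rw [← Finset.sum_neg_distrib]
    refine Finset.sum_congr rfl fun i _ => ?_
    rw [integral_neg, integral_eq_integral_rnDeriv_mul (hQ i) hS, mul_neg,
      ← integral_const_mul]
    simp only [mul_assoc]
  rw [this]
  ring

/-- Bounded random vectors are approximated from below by vectors with finitely many values. -/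
theorem exists_finite_approx {P : Measure Ω} {d : ℕ} {X : Ω → Fin d → ℝ}
    (hX : MemLp X ∞ P) {δ : ℝ} (hδ : 0 < δ) :
    ∃ (N : ℕ) (ξ : Ω → Fin d → Fin (N + 1)) (x : (Fin d → Fin (N + 1)) → Fin d → ℝ),
      Measurable ξ ∧ ∀ᵐ ω ∂P, ∀ i, x (ξ ω) i ≤ X ω i ∧ X ω i ≤ x (ξ ω) i + δ := by
  obtain ⟨M, hM⟩ := exists_ae_abs_le hX.norm
  obtain ⟨N, hN⟩ := exists_nat_ge (2 * M / δ)
  let X' := hX.1.mk X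
  have hX' : Measurable X' := hX.1.stronglyMeasurable_mk.measurable
  -- The cap at `N` acts only on the null set where the bound `M` fails.
  let k : ℕ → Fin (N + 1) := fun n => ⟨min n N, by omega⟩
  refine ⟨N, fun ω i => k ⌊(X' ω i + M) / δ⌋₊, fun j i => -M + δ * (j i : ℕ), ?_, ?_⟩
  · refine measurable_pi_lambda _ fun i => (measurable_of_countable k).comp ?_
    exact Nat.measurable_floor.comp (by fun_prop)
  · filter_upwards [hM, hX.1.ae_eq_mk] with ω h1 h2 i
    have h3 : |X ω i| ≤ M := by
      rw [abs_norm] at h1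
      exact (norm_le_pi_norm (X ω) i).trans h1
    have h4 : X' ω i = X ω i := by rw [h2]
    obtain ⟨h5, h6⟩ := abs_le.1 h3
    set t := (X' ω i + M) / δ with ht
    have ht' : t * δ = X ω i + M := by rw [ht, h4, div_mul_cancel₀ _ hδ.ne']
    have ht0 : 0 ≤ t := div_nonneg (by rw [h4]; linarith) hδ.le
    have htN : ⌊t⌋₊ ≤ N := by
      refine Nat.floor_le_of_le (le_trans ?_ hN)
      rw [ht, h4]
      gcongr
      linarith
    have hk : ((k ⌊t⌋₊ : Fin (N + 1)) : ℕ) = ⌊t⌋₊ := min_eq_left htN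
    rw [hk]
    have h7 := Nat.floor_le ht0
    have h8 := Nat.lt_floor_add_one t
    constructor <;> nlinarith

end

/-! ### Strong duality for finitely valued positions -/

section

variable {Ω : Type*} [MeasurableSpace Ω]

/-- Turns an additive error into a relative one: within `η * m` of `s j`, a nonnegative weight is at
least `(1 - η) * s j`. -/
theorem exists_pos_forall_eq_zero_or_le {J : Type*} [Finite J] {s : J → ℝ} (hs : ∀ j, 0 ≤ s j) :
    ∃ m > 0, ∀ j, s j = 0 ∨ m ≤ s j := by
  have h : ∀ᶠ m in 𝓝[>] (0 : ℝ), ∀ j, s j = 0 ∨ m ≤ s j := by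
    refine eventually_all.2 fun j => ?_
    rcases (hs j).eq_or_lt with h | h
    · exact Eventually.of_forall fun m => Or.inl h.symm
    · filter_upwards [Ioo_mem_nhdsGT h] with m hm
      exact Or.inr hm.2.le
  obtain ⟨m, hm, hm0⟩ := (h.and self_mem_nhdsWithin).exists
  exact ⟨m, hm0, hm⟩

theorem dotProduct_le_norm_mul_sum {d : ℕ} {v : Fin d → ℝ} (hv : 0 ≤ v) (x : Fin d → ℝ) :
    v ⬝ᵥ x ≤ ‖x‖ * ∑ i, v i := by
  rw [dotProduct, Finset.mul_sum]
  refine Finset.sum_le_sum fun i _ => ?_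
  rw [mul_comm]
  exact mul_le_mul_of_nonneg_right ((le_abs_self _).trans (norm_le_pi_norm x i)) (hv i)

/-- A slope that is dominated along all shifts of an aggregated position has a finite conjugate. -/
theorem IsAggregation.exists_sub_dotProduct_le {P : Measure Ω} [IsProbabilityMeasure P]
    {ρ : (Ω → ℝ) → ℝ} (hρ : IsConvexRiskMeasure P ρ) {d : ℕ} {Λ : (Fin d → ℝ) → ℝ}
    (hΛ : IsAggregation Λ) {X : Ω → Fin d → ℝ} (hX : MemLp X ∞ P) {v : Fin d → ℝ} {c : ℝ}
    (h : ∀ z, c - v ⬝ᵥ z ≤ ρ fun ω => Λ (X ω + z)) : ∃ g, ∀ u, Λ u - v ⬝ᵥ u ≤ g := by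
  obtain ⟨M, hM⟩ := exists_ae_abs_le hX.norm
  refine ⟨(ρ fun _ => 0) - c + v ⬝ᵥ fun _ => M, fun u => ?_⟩
  have h1 := h (u + fun _ => M)
  have h2 : (ρ fun ω => Λ (X ω + (u + fun _ => M))) ≤ ρ fun _ => Λ u := by
    refine hρ.monotone _ _ (hΛ.memLp_comp (hX.add (memLp_const _))) (memLp_const _) ?_
    filter_upwards [hM] with ω hω
    refine hΛ.increasing _ _ fun i => ?_
    rw [abs_norm] at hω
    have h3 := (abs_le.1 ((norm_le_pi_norm (X ω) i).trans hω)).1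
    simp only [Pi.add_apply]
    linarith
  rw [hρ.const] at h2
  rw [dotProduct_add] at h1
  linarith

/-- The dual elements for a position with finitely many values: a measure equivalent to `P` and a
random slope, constant on the cells of the partition, whose expectation is `v`. -/
theorem IsAggregation.exists_slope_of_finite {P : Measure Ω} [IsProbabilityMeasure P]
    {ρ : (Ω → ℝ) → ℝ} (hρ : IsConvexRiskMeasure P ρ) {d : ℕ} {Λ : (Fin d → ℝ) → ℝ}
    (hΛ : IsAggregation Λ) {J : Type*} [Fintype J] [MeasurableSpace J]
    [MeasurableSingletonClass J] {ξ : Ω → J} (hξ : Measurable ξ) {x : J → Fin d → ℝ}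
    {v : Fin d → ℝ} (hv : 0 ≤ v) {c : ℝ}
    (h : ∀ z, c - v ⬝ᵥ z ≤ ρ fun ω => Λ (x (ξ ω) + z)) {S₀ : Measure Ω}
    (hS₀ : S₀ ∈ equivMeasures P) {a₀ : ℝ} (ha₀ : PenaltyLE P ρ S₀ a₀) {ε : ℝ} (hε : 0 < ε) :
    ∃ S ∈ equivMeasures P, ∃ (a : ℝ) (z : J → Fin d → ℝ) (G : J → ℝ), PenaltyLE P ρ S a ∧
      (∀ j, 0 ≤ z j) ∧ ∑ j, S.real (ξ ⁻¹' {j}) • z j = v ∧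
      (∀ j, S.real (ξ ⁻¹' {j}) = 0 → z j = 0) ∧
      (∀ j, 0 < S.real (ξ ⁻¹' {j}) → ∀ u, Λ u - z j ⬝ᵥ u ≤ G j) ∧
      a + ∑ j, S.real (ξ ⁻¹' {j}) * G j + ∑ j, S.real (ξ ⁻¹' {j}) * (z j ⬝ᵥ x j) ≤ -c + ε := by
  classical
  have hx : MemLp (fun ω => x (ξ ω)) ∞ P :=
    memLp_top_of_bound ((measurable_of_finite x).comp hξ).aestronglyMeasurable ‖x‖
      (ae_of_all _ fun ω => norm_le_pi_norm x _)
  obtain ⟨g, hg⟩ := hΛ.exists_sub_dotProduct_le hρ hx h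
  obtain ⟨s, b, ζ, γ, hs0, hs1, hsb, hζγ, hζv, hcost⟩ := hΛ.exists_dual
    (Φ := fun y : J → ℝ => ρ fun ω => y (ξ ω)) (x := x) (v := v) (c := c)
    ⟨convex_univ, fun y _ y' _ p q hp hq hpq =>
      hρ.convex_comb (memLp_comp_finite hξ y) (memLp_comp_finite hξ y') hp hq hpq⟩
    (fun y r => hρ.translative _ r (memLp_comp_finite hξ y))
    (fun y y' hy => hρ.monotone _ _ (memLp_comp_finite hξ y') (memLp_comp_finite hξ y)
      (ae_of_all _ fun ω => hy _)) h
  have hζ0 : ∀ j, 0 ≤ ζ j := by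
    intro j i
    have h1 : ∀ t : ℝ, 0 ≤ t → s j * Λ 0 - γ j ≤ ζ j i * t := by
      intro t ht
      have h2 := hζγ j (Pi.single i t)
      have h3 : Λ 0 ≤ Λ (Pi.single i t) := hΛ.increasing _ _ (Pi.single_nonneg.2 ht)
      rw [dotProduct_single] at h2
      linarith [mul_le_mul_of_nonneg_left h3 (hs0 j)]
    by_contra hneg
    simp only [Pi.zero_apply, not_le] at hneg
    have h4 := h1 ((|s j * Λ 0 - γ j| + 1) / (-ζ j i))
      (div_nonneg (by positivity) (by linarith))
    have h5 : (|s j * Λ 0 - γ j| + 1) / (-ζ j i) * (-ζ j i) = |s j * Λ 0 - γ j| + 1 :=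
      div_mul_cancel₀ _ (by linarith)
    linarith [neg_abs_le (s j * Λ 0 - γ j)]
  have hzero : ∀ j, s j = 0 → ζ j = 0 ∧ 0 ≤ γ j := by
    intro j hj
    have h1 : ∀ u, 0 ≤ ζ j ⬝ᵥ u + γ j := fun u => by simpa [hj] using hζγ j u
    exact ⟨eq_zero_of_forall_le_dotProduct (k := -γ j) fun u => by linarith [h1 u],
      by simpa using h1 0⟩
  set M := ‖x‖ * ∑ i, v i with hM
  obtain ⟨m, hm, hms⟩ := exists_pos_forall_eq_zero_or_le hs0
  -- Bound for the dual value when a share `η` of `S₀` is mixed in. One factor `1 - η` comes from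
  -- approximating `s`, the other from the mixture; at `η = 0` this is the finite-dimensional dual
  -- value.
  let cost : ℝ → ℝ := fun η => (1 - η) * (b + η) + η * a₀ + ((1 - η) ^ 2 * ∑ j, γ j +
    (1 - (1 - η) ^ 2) * g) + ((1 - η) ^ 2 * ∑ j, ζ j ⬝ᵥ x j + (1 - (1 - η) ^ 2) * M)
  have hlim : ∀ᶠ η in 𝓝[>] (0 : ℝ), cost η < -c + ε := by
    have hcont : Continuous cost := by fun_prop
    have h0 : cost 0 < -c + ε := by
      simp only [cost]
      ring_nf
      linarith
    exact ((hcont.tendsto 0).eventually_lt_const h0).filter_mono nhdsWithin_le_nhds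
  obtain ⟨η, hηcost, hη0, hη1⟩ := (hlim.and (Ioo_mem_nhdsGT (zero_lt_one' ℝ))).exists
  obtain ⟨S₁, hS₁, hp₁, happ⟩ := hρ.exists_approx hξ hsb (lt_min hη0 (mul_pos hη0 hm))
  have := hS₁.1
  have := hS₀.1
  have hS := mixMeasure_mem_equiv hS₁ hS₀ hη0 hη1.le
  set S := mixMeasure η S₁ S₀ with hSdef
  have := hS.1
  set θ : ℝ := (1 - η) ^ 2 with hθ
  set π : J → ℝ := fun j => S.real (ξ ⁻¹' {j}) with hπ
  have hπ0 : ∀ j, 0 ≤ π j := fun j => measureReal_nonneg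
  have hπ1 : ∑ j, π j = 1 := sum_real_preimage_singleton S hξ
  have hπs : ∀ j, θ * s j ≤ π j := by
    intro j
    have h1 : (1 - η) * s j ≤ S₁.real (ξ ⁻¹' {j}) := by
      rcases hms j with h0 | h0
      · rw [h0, mul_zero]; exact measureReal_nonneg
      · have h2 := (abs_lt.1 ((happ j).trans_le (min_le_right _ _))).1
        have h3 := mul_le_mul_of_nonneg_left h0 hη0.le
        linarith
    have h2 : π j = (1 - η) * S₁.real (ξ ⁻¹' {j}) + η * S₀.real (ξ ⁻¹' {j}) :=
      real_mixMeasure hη0.le hη1.le _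
    have h3 : 0 ≤ η * S₀.real (ξ ⁻¹' {j}) := mul_nonneg hη0.le measureReal_nonneg
    have h4 := mul_le_mul_of_nonneg_left h1 (by linarith : 0 ≤ 1 - η)
    rw [h2, hθ]
    linarith
  have hθ0 : 0 < θ := by
    have : 0 < 1 - η := by linarith
    positivity
  have hr0 : ∀ j, 0 ≤ π j - θ * s j := fun j => sub_nonneg.2 (hπs j)
  have hr1 : ∑ j, (π j - θ * s j) = 1 - θ := by
    rw [Finset.sum_sub_distrib, ← Finset.mul_sum, hs1, hπ1, mul_one]
  have hs_of_π : ∀ j, π j = 0 → s j = 0 := fun j hj => by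
    have h1 := hπs j
    rw [hj] at h1
    have h2 := mul_nonneg hθ0.le (hs0 j)
    exact (mul_eq_zero.1 (le_antisymm h1 h2)).resolve_left hθ0.ne'
  -- Of the mass `π j`, the part `θ * s j` carries the dual slope and the surplus carries `v`, so
  -- the mean remains `v`. On null cells the convention `0⁻¹ = 0` gives slope zero.
  set z : J → Fin d → ℝ := fun j => (π j)⁻¹ • (θ • ζ j + (π j - θ * s j) • v) with hz
  set G : J → ℝ := fun j => (π j)⁻¹ * (θ * γ j + (π j - θ * s j) * g) with hG
  have hπz : ∀ j, π j • z j = θ • ζ j + (π j - θ * s j) • v := by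
    intro j
    by_cases hj : π j = 0
    · simp [hj, hs_of_π j hj, (hzero j (hs_of_π j hj)).1]
    · rw [hz, smul_smul, mul_inv_cancel₀ hj, one_smul]
  have hπG : ∀ j, π j * G j ≤ θ * γ j + (π j - θ * s j) * g := by
    intro j
    by_cases hj : π j = 0
    · rw [hj, hs_of_π j hj]
      have := mul_nonneg hθ0.le (hzero j (hs_of_π j hj)).2
      linarith
    · rw [hG, ← mul_assoc, mul_inv_cancel₀ hj, one_mul]
  refine ⟨S, hS, (1 - η) * (b + η) + η * a₀, z, G, ?_, ?_, ?_, ?_, ?_, ?_⟩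
  · exact penaltyLE_mixMeasure hS₁ ⟨hS₀.1, hS₀.2.1⟩ hη0.le hη1.le
      (fun Y hY => (hp₁ Y hY).trans (by linarith [min_le_left η (η * m)])) ha₀
  · intro j
    exact smul_nonneg (inv_nonneg.2 (hπ0 j)) (add_nonneg (smul_nonneg hθ0.le (hζ0 j))
      (smul_nonneg (hr0 j) hv))
  · change ∑ j, π j • z j = v
    simp_rw [hπz]
    rw [Finset.sum_add_distrib, ← Finset.smul_sum, ← Finset.sum_smul, hζv, hr1, ← add_smul]
    simp
  · intro j hj
    change π j = 0 at hj
    simp [hz, hj]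
  · intro j hj u
    change 0 < π j at hj
    have h1 : π j * (z j ⬝ᵥ u) = θ * (ζ j ⬝ᵥ u) + (π j - θ * s j) * (v ⬝ᵥ u) := by
      rw [← smul_eq_mul, ← smul_dotProduct, hπz, add_dotProduct, smul_dotProduct, smul_dotProduct,
        smul_eq_mul, smul_eq_mul]
    have h2 : π j * G j = θ * γ j + (π j - θ * s j) * g := by
      rw [hG, ← mul_assoc, mul_inv_cancel₀ hj.ne', one_mul]
    have h3 := mul_le_mul_of_nonneg_left (hζγ j u) hθ0.le
    have h4 := mul_le_mul_of_nonneg_left (hg u) (hr0 j)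
    refine le_of_mul_le_mul_left ?_ hj
    rw [mul_sub, h1, h2]
    linarith
  · change (1 - η) * (b + η) + η * a₀ + ∑ j, π j * G j + ∑ j, π j * (z j ⬝ᵥ x j) ≤ -c + ε
    have h1 : ∑ j, π j * G j ≤ θ * ∑ j, γ j + (1 - θ) * g := by
      refine (Finset.sum_le_sum fun j _ => hπG j).trans (le_of_eq ?_)
      rw [Finset.sum_add_distrib, ← Finset.mul_sum, ← Finset.sum_mul, hr1]
    have h2 : ∑ j, π j * (z j ⬝ᵥ x j) ≤ θ * ∑ j, ζ j ⬝ᵥ x j + (1 - θ) * M := by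
      have : ∀ j, π j * (z j ⬝ᵥ x j) ≤ θ * (ζ j ⬝ᵥ x j) + (π j - θ * s j) * M := by
        intro j
        rw [← smul_eq_mul, ← smul_dotProduct, hπz, add_dotProduct, smul_dotProduct,
          smul_dotProduct, smul_eq_mul, smul_eq_mul]
        have h3 : v ⬝ᵥ x j ≤ M := (dotProduct_le_norm_mul_sum hv _).trans
          (mul_le_mul_of_nonneg_right (norm_le_pi_norm x j) (Finset.sum_nonneg fun i _ => hv i))
        linarith [mul_le_mul_of_nonneg_left h3 (hr0 j)]
      refine (Finset.sum_le_sum fun j _ => this j).trans (le_of_eq ?_)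
      rw [Finset.sum_add_distrib, ← Finset.mul_sum, ← Finset.sum_mul, hr1]
    have h3 : cost η = (1 - η) * (b + η) + η * a₀ + (θ * ∑ j, γ j + (1 - θ) * g) +
      (θ * ∑ j, ζ j ⬝ᵥ x j + (1 - θ) * M) := rfl
    linarith

end

/-! ### Strong duality for bounded positions -/

section

variable {Ω : Type*} [MeasurableSpace Ω]

theorem penaltyLE_of_penalty_lt_top {P : Measure Ω} {ρ : (Ω → ℝ) → ℝ} {S : Measure Ω}
    (h : penalty P ρ S < ⊤) : PenaltyLE P ρ S (penalty P ρ S).toReal := by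
  intro Y hY
  have h1 : ((∫ ω, -Y ω ∂S : ℝ) : EReal) ≤ penalty P ρ S := le_iSup₂_of_le Y hY le_rfl
  exact_mod_cast h1.trans (EReal.le_coe_toReal h.ne)

theorem PenaltyLE.penalty_le {P : Measure Ω} {ρ : (Ω → ℝ) → ℝ} {S : Measure Ω} {a : ℝ}
    (h : PenaltyLE P ρ S a) : penalty P ρ S ≤ a :=
  iSup₂_le fun Y hY => by exact_mod_cast h Y hY

/-- Strong duality for the systemic penalty function: an affine minorant of the shifted risk is
almost attained by a vector of probability measures. -/
theorem IsAggregation.exists_sysPenalty_le {P : Measure Ω} [IsProbabilityMeasure P]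
    {ρ : (Ω → ℝ) → ℝ} (hρ : IsConvexRiskMeasure P ρ) {d : ℕ} {Λ : (Fin d → ℝ) → ℝ}
    (hΛ : IsAggregation Λ) (hpen : ∃ S ∈ equivMeasures P, penalty P ρ S < ⊤)
    {X : Ω → Fin d → ℝ} (hX : MemLp X ∞ P) {v : Fin d → ℝ} (hv : 0 ≤ v) {c : ℝ}
    (h : ∀ z, c - v ⬝ᵥ z ≤ ρ fun ω => Λ (X ω + z)) {ε : ℝ} (hε : 0 < ε) :
    ∃ Q ∈ vectorMeasures P d,
      sysPenalty P ρ Λ Q v ≤ ((weightedLoss Q v X - c + ε : ℝ) : EReal) := by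
  classical
  obtain ⟨S₀, hS₀, hp₀⟩ := hpen
  have hσ : 0 ≤ ∑ i, v i := Finset.sum_nonneg fun i _ => hv i
  set δ := ε / 2 / (∑ i, v i + 1) with hδdef
  have hδ : 0 < δ := by positivity
  have hδv : δ * ∑ i, v i ≤ ε / 2 := by
    have : δ * (∑ i, v i + 1) = ε / 2 := div_mul_cancel₀ _ (by positivity)
    linarith
  obtain ⟨N, ξ, x, hξ, happ⟩ := exists_finite_approx hX hδ
  have hx : MemLp (fun ω => x (ξ ω)) ∞ P :=
    memLp_top_of_bound ((measurable_of_finite x).comp hξ).aestronglyMeasurable ‖x‖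
      (ae_of_all _ fun ω => norm_le_pi_norm x _)
  -- Rounding down only raises the risk, so the minorant survives. The mesh `δ` keeps the loss in
  -- the linear term below `ε / 2`.
  obtain ⟨S, hS, a, z, G, ha, hz0, hzv, hzπ, hG, hcost⟩ := hΛ.exists_slope_of_finite hρ hξ hv
    (x := x) (c := c) (fun u => (h u).trans (hρ.monotone _ _
      (hΛ.memLp_comp (hX.add (memLp_const u))) (hΛ.memLp_comp (hx.add (memLp_const u))) (by
        filter_upwards [happ] with ω hω
        exact hΛ.increasing _ _ fun i => add_le_add (hω i).1 le_rfl)))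
    hS₀ (penaltyLE_of_penalty_lt_top hp₀) (half_pos hε)
  have hSP := hS.1
  set π : (Fin d → Fin (N + 1)) → ℝ := fun j => S.real (ξ ⁻¹' {j}) with hπ
  have hπ0 : ∀ j, 0 ≤ π j := fun j => measureReal_nonneg
  have hπ1 : ∑ j, π j = 1 := sum_real_preimage_singleton S hξ
  have hzvi : ∀ i, ∑ j, π j * z j i = v i := fun i => by
    have := congrFun hzv i
    simpa [Finset.sum_apply] using this
  -- Densities of `Q i` with respect to `S`. If `v i = 0` the slope has vanishing `i`-th component
  -- and any density would do; the value `1` makes `Q i` equal to `S`.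
  let q : Fin d → (Fin d → Fin (N + 1)) → ℝ := fun i j => if v i = 0 then 1 else z j i / v i
  have hq0 : ∀ i j, 0 ≤ q i j := by
    intro i j
    by_cases hi : v i = 0
    · simp [q, hi]
    · simp only [q, hi, if_false]
      exact div_nonneg (hz0 j i) (hv i)
  have hvq : ∀ i j, v i * q i j = z j i := by
    intro i j
    by_cases hi : v i = 0
    · have h1 : π j * z j i = 0 :=
        (Finset.sum_eq_zero_iff_of_nonneg fun j _ => mul_nonneg (hπ0 j) (hz0 j i)).1
          ((hzvi i).trans hi) j (Finset.mem_univ j)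
      rw [hi, zero_mul]
      rcases mul_eq_zero.1 h1 with h2 | h2
      · rw [hzπ j h2]; rfl
      · exact h2.symm
    · simp only [q, hi, if_false]
      exact mul_div_cancel₀ _ hi
  have hqm : ∀ i, Measurable fun ω => q i (ξ ω) := fun i => (measurable_of_finite (q i)).comp hξ
  have hqi : ∀ i, Integrable (fun ω => q i (ξ ω)) S := fun i =>
    (memLp_comp_finite hξ (q i)).integrable le_top
  have hq0' : ∀ i, 0 ≤ᵐ[S] fun ω => q i (ξ ω) := fun i => ae_of_all _ fun ω => hq0 i _
  have hq1 : ∀ i, ∫ ω, q i (ξ ω) ∂S = 1 := by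
    intro i
    rw [integral_comp_finite S hξ (q i)]
    by_cases hi : v i = 0
    · simp only [q, hi, if_true, mul_one]
      exact hπ1
    · refine mul_left_cancel₀ hi ?_
      rw [Finset.mul_sum, mul_one]
      refine (Finset.sum_congr rfl fun j _ => ?_).trans (hzvi i)
      rw [mul_left_comm, hvq]
  let Q : Fin d → Measure Ω := fun i => densityMeasure S fun ω => q i (ξ ω)
  have hQ : Q ∈ vectorMeasures P d := fun i =>
    ⟨isProbabilityMeasure_densityMeasure (hqi i) (hq0' i) (hq1 i),
      (withDensity_absolutelyContinuous _ _).trans hS.2.1⟩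
  have hrn : ∀ᵐ ω ∂S, ∀ i, v i * ((Q i).rnDeriv S ω).toReal = z (ξ ω) i := by
    refine ae_all_iff.2 fun i => ?_
    filter_upwards [Measure.rnDeriv_withDensity S (hqm i).ennreal_ofReal] with ω hω
    change v i * (((S.withDensity fun ω => ENNReal.ofReal (q i (ξ ω))).rnDeriv S) ω).toReal = _
    rw [hω, ENNReal.toReal_ofReal (hq0 i _), hvq]
  have hpos : ∀ᵐ ω ∂S, 0 < π (ξ ω) := by
    have hall : ∀ᵐ ω ∂S, ∀ j, π j = 0 → ξ ω ≠ j := by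
      refine ae_all_iff.2 fun j => ?_
      by_cases hj : π j = 0
      · have h1 : S (ξ ⁻¹' {j}) = 0 := (measureReal_eq_zero_iff (measure_ne_top _ _)).1 hj
        filter_upwards [measure_eq_zero_iff_ae_notMem.1 h1] with ω hω _
        exact hω
      · exact ae_of_all _ fun ω h => absurd h hj
    filter_upwards [hall] with ω hω
    exact lt_of_le_of_ne (hπ0 _) fun h0 => hω _ h0.symm rfl
  have hdiv : divergence Λ Q v S ≤ ((∑ j, π j * G j : ℝ) : EReal) := by
    rw [← integral_comp_finite S hξ G,
      ← extExpectation_coe ((memLp_comp_finite hξ G).integrable le_top)]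
    refine extExpectation_mono ?_
    filter_upwards [hrn, hpos] with ω h1 h2
    refine iSup_le fun u => ?_
    have h3 : (fun i => v i * ((Q i).rnDeriv S ω).toReal) = z (ξ ω) := funext h1
    rw [h3]
    exact_mod_cast hG _ h2 u
  have hloss : -∑ j, π j * (z j ⬝ᵥ x j) ≤ weightedLoss Q v X + ε / 2 := by
    have iX : ∀ i, Integrable (fun ω => q i (ξ ω) * X ω i) S := fun i =>
      (hqi i).mul_of_top_left (memLp_top_of_absolutelyContinuous hS.2.1 (memLp_apply hX i))
    have ix : ∀ i, Integrable (fun ω => q i (ξ ω) * (x (ξ ω) i + δ)) S := fun i =>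
      (memLp_comp_finite hξ fun j => q i j * (x j i + δ)).integrable le_top
    have h1 : ∀ i, v i * ∫ ω, q i (ξ ω) * X ω i ∂S ≤ (∑ j, π j * (z j i * x j i)) + δ * v i := by
      intro i
      have h2 : ∫ ω, q i (ξ ω) * X ω i ∂S ≤ ∫ ω, q i (ξ ω) * (x (ξ ω) i + δ) ∂S := by
        refine integral_mono_ae (iX i) (ix i) ?_
        filter_upwards [hS.2.1.ae_le happ] with ω hω
        exact mul_le_mul_of_nonneg_left (hω i).2 (hq0 i _)
      refine (mul_le_mul_of_nonneg_left h2 (hv i)).trans (le_of_eq ?_)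
      calc v i * ∫ ω, q i (ξ ω) * (x (ξ ω) i + δ) ∂S
          = ∑ j, π j * (v i * q i j * (x j i + δ)) := by
            rw [integral_comp_finite S hξ fun j => q i j * (x j i + δ), Finset.mul_sum]
            exact Finset.sum_congr rfl fun j _ => by ring
        _ = ∑ j, (π j * (z j i * x j i) + δ * (π j * z j i)) :=
            Finset.sum_congr rfl fun j _ => by rw [hvq]; ring
        _ = (∑ j, π j * (z j i * x j i)) + δ * v i := by
            rw [Finset.sum_add_distrib, ← Finset.mul_sum, hzvi]
    have h3 : weightedLoss Q v X = -∑ i, v i * ∫ ω, q i (ξ ω) * X ω i ∂S := by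
      rw [weightedLoss, ← Finset.sum_neg_distrib]
      refine Finset.sum_congr rfl fun i _ => ?_
      rw [integral_neg, integral_densityMeasure (hqi i) (hq0' i), mul_neg]
    have h4 : ∑ i, v i * ∫ ω, q i (ξ ω) * X ω i ∂S ≤
        ∑ j, π j * (z j ⬝ᵥ x j) + δ * ∑ i, v i := by
      refine (Finset.sum_le_sum fun i _ => h1 i).trans (le_of_eq ?_)
      rw [Finset.sum_add_distrib, ← Finset.mul_sum, Finset.sum_comm]
      simp only [dotProduct, Finset.mul_sum]
    linarith
  refine ⟨Q, hQ, (iInf₂_le S hS).trans ((add_le_add ha.penalty_le hdiv).trans ?_)⟩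
  have : a + ∑ j, π j * G j ≤ weightedLoss Q v X - c + ε := by
    change a + ∑ j, π j * G j + ∑ j, π j * (z j ⬝ᵥ x j) ≤ -c + ε / 2 at hcost
    linarith
  exact_mod_cast this

end

/-! ### Minorants and Lagrange multipliers for the shifted risk -/

section

variable {Ω : Type*} [MeasurableSpace Ω]

/-- A nonconstant increasing `Λ` grows strictly between some `p ≤ q`. By concavity it lies below the
chord through `q` and `p` prolonged beyond `p`, which tends to `-∞`; monotonicity carries this to
the diagonal. -/
theorem exists_aggregated_le {d : ℕ} {Λ : (Fin d → ℝ) → ℝ} (hΛ : IsAggregation Λ) (B : ℝ) :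
    ∃ K : ℝ, ∀ K' ≥ K, Λ (fun _ => -K') ≤ B := by
  obtain ⟨p, q, hpq, hlt⟩ : ∃ p q : Fin d → ℝ, p ≤ q ∧ Λ p < Λ q := by
    obtain ⟨x, z, hxz⟩ := hΛ.nonconstant
    rcases lt_or_gt_of_ne hxz with h | h
    · exact ⟨x, x ⊔ z, le_sup_left, h.trans_le (hΛ.increasing _ _ le_sup_right)⟩
    · exact ⟨z, x ⊔ z, le_sup_right, h.trans_le (hΛ.increasing _ _ le_sup_left)⟩
  set t : ℝ := 1 + |Λ q - B| / (Λ q - Λ p) with ht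
  have ht1 : 1 ≤ t := le_add_of_nonneg_right (div_nonneg (abs_nonneg _) (by linarith))
  have htB : |Λ q - B| ≤ t * (Λ q - Λ p) := by
    rw [ht, add_mul, div_mul_cancel₀ _ (by linarith)]
    linarith
  set y := q - t • (q - p) with hy
  have hconc := hΛ.concave y q t⁻¹ (by positivity) (inv_le_one_of_one_le₀ ht1)
  have e : t⁻¹ • y + (1 - t⁻¹) • q = p := by
    ext i
    simp only [hy, Pi.add_apply, Pi.smul_apply, Pi.sub_apply, smul_eq_mul]
    field_simp
    ring
  rw [e] at hconc
  have hty : Λ y ≤ Λ q - t * (Λ q - Λ p) := by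
    have := mul_le_mul_of_nonneg_left hconc (by linarith : 0 ≤ t)
    have h1 : t * (t⁻¹ * Λ y + (1 - t⁻¹) * Λ q) = Λ y + (t - 1) * Λ q := by
      field_simp
    rw [h1] at this
    linarith
  refine ⟨‖y‖, fun K' hK' => (hΛ.increasing _ y fun i => ?_).trans ?_⟩
  · linarith [(abs_le.1 (norm_le_pi_norm y i)).1]
  · linarith [le_abs_self (Λ q - B)]

section shifted

variable {P : Measure Ω} [IsProbabilityMeasure P] {ρ : (Ω → ℝ) → ℝ} {d : ℕ}
  {Λ : (Fin d → ℝ) → ℝ} {X : Ω → Fin d → ℝ}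

/-- The risk of the aggregated position as a function of the deterministic capital added. -/
def shiftedRisk (ρ : (Ω → ℝ) → ℝ) (Λ : (Fin d → ℝ) → ℝ) (X : Ω → Fin d → ℝ) (z : Fin d → ℝ) : ℝ :=
  ρ fun ω => Λ (X ω + z)

theorem memLp_shifted (hΛ : IsAggregation Λ) (hX : MemLp X ∞ P) (z : Fin d → ℝ) :
    MemLp (fun ω => Λ (X ω + z)) ∞ P := hΛ.memLp_comp (hX.add (memLp_const z))

theorem antitone_shiftedRisk (hρ : IsConvexRiskMeasure P ρ) (hΛ : IsAggregation Λ)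
    (hX : MemLp X ∞ P) : Antitone (shiftedRisk ρ Λ X) := fun z z' h =>
  hρ.monotone _ _ (memLp_shifted hΛ hX z') (memLp_shifted hΛ hX z)
    (ae_of_all _ fun _ => hΛ.increasing _ _ (add_le_add le_rfl h))

theorem convexOn_shiftedRisk (hρ : IsConvexRiskMeasure P ρ) (hΛ : IsAggregation Λ)
    (hX : MemLp X ∞ P) : ConvexOn ℝ Set.univ (shiftedRisk ρ Λ X) := by
  refine ⟨convex_univ, fun z _ z' _ a b ha hb hab => ?_⟩
  refine le_trans ?_ (hρ.convex_comb (memLp_shifted hΛ hX z) (memLp_shifted hΛ hX z') ha hb hab)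
  refine hρ.monotone _ _ (memLp_shifted hΛ hX _)
    (((memLp_shifted hΛ hX z).const_mul a).add ((memLp_shifted hΛ hX z').const_mul b))
    (ae_of_all _ fun ω => ?_)
  have e : X ω + (a • z + b • z') = a • (X ω + z) + b • (X ω + z') := by
    rw [smul_add, smul_add, add_add_add_comm, ← add_smul, hab, one_smul]
  rw [e]
  exact hΛ.concaveOn.2 (Set.mem_univ _) (Set.mem_univ _) ha hb hab

/-- Withdrawing capital makes the risk arbitrarily large. -/
theorem exists_le_shiftedRisk (hρ : IsConvexRiskMeasure P ρ) (hΛ : IsAggregation Λ)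
    (hX : MemLp X ∞ P) (B : ℝ) : ∃ K : ℝ, ∀ K' ≥ K, B ≤ shiftedRisk ρ Λ X fun _ => -K' := by
  obtain ⟨M, hM⟩ := exists_ae_abs_le hX.norm
  obtain ⟨K, hK⟩ := exists_aggregated_le hΛ ((ρ fun _ => 0) - B)
  refine ⟨K + M, fun K' hK' => ?_⟩
  have h1 : ρ (fun _ => Λ fun _ => -(K' - M)) ≤ shiftedRisk ρ Λ X fun _ => -K' := by
    refine hρ.monotone _ _ (memLp_const _) (memLp_shifted hΛ hX _) ?_
    filter_upwards [hM] with ω hω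
    refine hΛ.increasing _ _ fun i => ?_
    rw [abs_norm] at hω
    have h3 := (abs_le.1 ((norm_le_pi_norm (X ω) i).trans hω)).2
    simp only [Pi.add_apply]
    linarith
  rw [hρ.const] at h1
  linarith [hK (K' - M) (by linarith)]

/-- Adding enough capital makes the position strictly acceptable if `ρ 0` is an interior value of
the aggregation function. -/
theorem exists_shiftedRisk_neg (hρ : IsConvexRiskMeasure P ρ) (hΛ : IsAggregation Λ)
    (hX : MemLp X ∞ P) (h0 : ρ (fun _ => 0) ∈ interior (Set.range Λ)) :
    ∃ z, shiftedRisk ρ Λ X z < 0 := by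
  obtain ⟨x, hx⟩ : ∃ x, ρ (fun _ => 0) < Λ x := by
    obtain ⟨ε, hε, hball⟩ := Metric.isOpen_iff.1 isOpen_interior _ h0
    have hmem : ρ (fun _ => 0) + ε / 2 ∈ Metric.ball (ρ fun _ => 0) ε := by
      rw [Metric.mem_ball, Real.dist_eq, add_sub_cancel_left, abs_of_pos (by linarith)]
      linarith
    obtain ⟨x, hx⟩ := interior_subset (hball hmem)
    exact ⟨x, by rw [hx]; linarith⟩
  obtain ⟨M, hM⟩ := exists_ae_abs_le hX.norm
  refine ⟨x + fun _ => M, ?_⟩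
  have h1 : (shiftedRisk ρ Λ X (x + fun _ => M)) ≤ ρ fun _ => Λ x := by
    refine hρ.monotone _ _ (memLp_shifted hΛ hX _) (memLp_const _) ?_
    filter_upwards [hM] with ω hω
    refine hΛ.increasing _ _ fun i => ?_
    rw [abs_norm] at hω
    have h3 := (abs_le.1 ((norm_le_pi_norm (X ω) i).trans hω)).1
    simp only [Pi.add_apply]
    linarith
  rw [hρ.const] at h1
  linarith

theorem exists_subgradient_shiftedRisk (hρ : IsConvexRiskMeasure P ρ) (hΛ : IsAggregation Λ)
    (hX : MemLp X ∞ P) (z₀ : Fin d → ℝ) : ∃ (v : Fin d → ℝ) (b : ℝ), 0 ≤ v ∧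
      (∀ z, b - v ⬝ᵥ z ≤ shiftedRisk ρ Λ X z) ∧ shiftedRisk ρ Λ X z₀ ≤ b - v ⬝ᵥ z₀ := by
  classical
  have hconv := convexOn_shiftedRisk hρ hΛ hX
  obtain ⟨f, b, h1, h2⟩ := exists_affine_between hconv hconv.locallyLipschitz.continuous
    (K := {(z₀, shiftedRisk ρ Λ X z₀)}) (convex_singleton _) (Set.singleton_nonempty _) (by simp)
  have hf : ∀ z, f z = -((fun i => -f (Pi.single i 1)) ⬝ᵥ z) := by
    intro z
    conv_lhs => rw [← Finset.univ_sum_single z]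
    rw [map_sum, dotProduct, ← Finset.sum_neg_distrib]
    refine Finset.sum_congr rfl fun i _ => ?_
    have : (Pi.single i (z i) : Fin d → ℝ) = z i • Pi.single i 1 := by
      rw [← Pi.single_smul]; simp
    rw [this, map_smul, smul_eq_mul]
    ring
  refine ⟨fun i => -f (Pi.single i 1), -b, fun i => ?_, fun z => ?_, ?_⟩
  · by_contra hneg
    simp only [Pi.zero_apply, not_le] at hneg
    set φ := f (Pi.single i 1) with hφ
    set t := (|shiftedRisk ρ Λ X 0 + b| + 1) / φ with ht
    have ht0 : 0 ≤ t := div_nonneg (by positivity) (by linarith)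
    have h3 := h1 (t • Pi.single i 1)
    have h4 : shiftedRisk ρ Λ X (t • Pi.single i 1) ≤ shiftedRisk ρ Λ X 0 :=
      antitone_shiftedRisk hρ hΛ hX (smul_nonneg ht0 (Pi.single_nonneg.2 zero_le_one))
    have h5 : t * φ = |shiftedRisk ρ Λ X 0 + b| + 1 := div_mul_cancel₀ _ (by linarith)
    rw [map_smul, smul_eq_mul, ← hφ, h5] at h3
    linarith [le_abs_self (shiftedRisk ρ Λ X 0 + b)]
  · have := h1 z
    rw [hf] at this
    linarith
  · have := h2 _ rfl
    rw [hf] at this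
    simp only at this
    linarith

/-- The risk at zero is approximated by affine minorants with nonzero slope. -/
theorem exists_weights_minorant (hρ : IsConvexRiskMeasure P ρ) (hΛ : IsAggregation Λ)
    (hX : MemLp X ∞ P) {ε : ℝ} (hε : 0 < ε) : ∃ v ∈ weights d, ∀ z,
      shiftedRisk ρ Λ X 0 - ε - v ⬝ᵥ z ≤ shiftedRisk ρ Λ X z := by
  obtain ⟨K, hK⟩ := exists_le_shiftedRisk hρ hΛ hX (shiftedRisk ρ Λ X 0 + 1)
  obtain ⟨v₀, b₀, hv₀, h₀, h₀'⟩ := exists_subgradient_shiftedRisk hρ hΛ hX 0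
  -- The subgradient at `0` may vanish, as when `0` minimises the risk. At `-K` the risk is larger
  -- than at `0`, so the slope there is nonzero, and a share `η` of it costs at most `ε` at the
  -- origin.
  obtain ⟨v₁, b₁, hv₁, h₁, h₁'⟩ := exists_subgradient_shiftedRisk hρ hΛ hX fun _ => -K
  have hne : v₁ ≠ 0 := by
    rintro rfl
    have h2 := h₁ 0
    have h3 := hK K le_rfl
    simp only [zero_dotProduct] at h2 h₁'
    linarith
  rw [dotProduct_zero, sub_zero] at h₀'
  set A := |shiftedRisk ρ Λ X 0 - b₁|
  set η := ε / (ε + A) with hη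
  have hA : 0 ≤ A := abs_nonneg _
  have hη0 : 0 < η := by positivity
  have hη1 : η ≤ 1 := div_le_one_of_le₀ (by linarith) (by positivity)
  have hηA : η * A ≤ ε := by
    rw [hη, div_mul_eq_mul_div, div_le_iff₀ (by positivity)]
    nlinarith
  refine ⟨(1 - η) • v₀ + η • v₁, ⟨add_nonneg (smul_nonneg (by linarith) hv₀)
    (smul_nonneg hη0.le hv₁), fun h0 => hne ?_⟩, fun z => ?_⟩
  · have := (add_eq_zero_iff_of_nonneg (smul_nonneg (by linarith : 0 ≤ 1 - η) hv₀)
      (smul_nonneg hη0.le hv₁)).1 h0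
    exact (smul_eq_zero.1 this.2).resolve_left hη0.ne'
  · rw [add_dotProduct, smul_dotProduct, smul_dotProduct, smul_eq_mul, smul_eq_mul]
    have e0 := mul_le_mul_of_nonneg_left (h₀ z) (by linarith : 0 ≤ 1 - η)
    have e1 := mul_le_mul_of_nonneg_left (h₁ z) hη0.le
    have e2 := mul_le_mul_of_nonneg_left h₀' (by linarith : 0 ≤ 1 - η)
    have e3 := mul_le_mul_of_nonneg_left (le_abs_self (shiftedRisk ρ Λ X 0 - b₁)) hη0.le
    change η * (shiftedRisk ρ Λ X 0 - b₁) ≤ η * A at e3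
    linarith

/-- The Lagrange multiplier for the capital requirement. -/
theorem exists_multiplier (hρ : IsConvexRiskMeasure P ρ) (hΛ : IsAggregation Λ)
    (hX : MemLp X ∞ P) (h0 : ρ (fun _ => 0) ∈ interior (Set.range Λ)) {w : Fin d → ℝ}
    (hw : w ∈ weights d) {c : ℝ} (h : ∀ z, shiftedRisk ρ Λ X z ≤ 0 → c ≤ w ⬝ᵥ z) :
    ∃ μ > 0, ∀ z, c ≤ w ⬝ᵥ z + μ * shiftedRisk ρ Λ X z := by
  set F := shiftedRisk ρ Λ X with hF
  have hσ : 0 < ∑ i, w i := by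
    refine lt_of_le_of_ne (Finset.sum_nonneg fun i _ => hw.1 i) fun hs => hw.2 ?_
    ext i
    exact (Finset.sum_eq_zero_iff_of_nonneg fun i _ => hw.1 i).1 hs.symm i (Finset.mem_univ i)
  obtain ⟨zn, hzn⟩ : ∃ z, F z < 0 := exists_shiftedRisk_neg hρ hΛ hX h0
  -- A point that is both too cheap and unacceptable forces `μ > 0`; the Slater point `zn` gives an
  -- upper bound for `μ`.
  obtain ⟨zp, hzp, hzpc⟩ : ∃ z, 0 < F z ∧ w ⬝ᵥ z < c := by
    obtain ⟨K, hK⟩ := exists_le_shiftedRisk hρ hΛ hX 1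
    set K' := max K ((|c| + 1) / ∑ i, w i)
    refine ⟨fun _ => -K', zero_lt_one.trans_le (hK K' (le_max_left _ _)), ?_⟩
    have h1 : (|c| + 1) / (∑ i, w i) * ∑ i, w i ≤ K' * ∑ i, w i :=
      mul_le_mul_of_nonneg_right (le_max_right _ _) hσ.le
    rw [div_mul_cancel₀ _ hσ.ne'] at h1
    have h2 : w ⬝ᵥ (fun _ => -K') = -(K' * ∑ i, w i) := by
      rw [dotProduct, ← Finset.sum_mul]
      ring
    rw [h2]
    linarith [neg_abs_le c]
  obtain ⟨μ, hμ1, hμ2⟩ := exists_between_of_forall_le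
    (s := {r | ∃ z, 0 < F z ∧ r = (c - w ⬝ᵥ z) / F z})
    (t := {r | ∃ z, F z < 0 ∧ r = (w ⬝ᵥ z - c) / (-F z)})
    ⟨_, zp, hzp, rfl⟩ ⟨_, zn, hzn, rfl⟩ (by
      rintro _ ⟨z₁, h₁, rfl⟩ _ ⟨z₂, h₂, rfl⟩
      rw [div_le_div_iff₀ h₁ (by linarith)]
      have hD : 0 < F z₁ - F z₂ := by linarith
      -- With these weights the chord of `F` between `z₁` and `z₂` vanishes, so by convexity the
      -- combined point is acceptable and costs at least `c`.
      have ha : 0 ≤ -F z₂ / (F z₁ - F z₂) := div_nonneg (by linarith) hD.le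
      have hb : 0 ≤ F z₁ / (F z₁ - F z₂) := div_nonneg h₁.le hD.le
      have hab : -F z₂ / (F z₁ - F z₂) + F z₁ / (F z₁ - F z₂) = 1 := by
        rw [← add_div, neg_add_eq_sub, div_self hD.ne']
      have h3 := (convexOn_shiftedRisk hρ hΛ hX).2 (Set.mem_univ z₁) (Set.mem_univ z₂) ha hb hab
      rw [← hF] at h3
      have h4 : -F z₂ / (F z₁ - F z₂) * F z₁ + F z₁ / (F z₁ - F z₂) * F z₂ = 0 := by
        field_simp
        ring
      simp only [smul_eq_mul, h4] at h3
      have h5 := h _ h3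
      rw [dotProduct_add, dotProduct_smul, dotProduct_smul, smul_eq_mul, smul_eq_mul,
        div_mul_eq_mul_div, div_mul_eq_mul_div, ← add_div, le_div_iff₀ hD] at h5
      linarith)
  have hμ1' : ∀ z, 0 < F z → c - w ⬝ᵥ z ≤ μ * F z := fun z hz =>
    (div_le_iff₀ hz).1 (hμ1 ⟨z, hz, rfl⟩)
  refine ⟨μ, ?_, fun z => ?_⟩
  · have := hμ1' zp hzp
    exact pos_of_mul_pos_left (by linarith : 0 < μ * F zp) hzp.le
  · rcases lt_trichotomy (F z) 0 with hz | hz | hz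
    · have := (le_div_iff₀ (by linarith : 0 < -F z)).1 (hμ2 ⟨z, hz, rfl⟩)
      linarith
    · rw [hz, mul_zero, add_zero]
      exact h z hz.le
    · linarith [hμ1' z hz]

end shifted

end

/-! ### The two dual representations and the counterexample -/

section

variable {Ω : Type*} [MeasurableSpace Ω] {P : Measure Ω} {ρ : (Ω → ℝ) → ℝ} {d : ℕ}
  {Λ : (Fin d → ℝ) → ℝ} {X : Ω → Fin d → ℝ}

theorem weightedLoss_smul (Q : Fin d → Measure Ω) (w : Fin d → ℝ) (a : ℝ) :
    weightedLoss Q (a • w) X = a * weightedLoss Q w X := by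
  rw [weightedLoss, weightedLoss, Finset.mul_sum]
  exact Finset.sum_congr rfl fun i _ => by rw [Pi.smul_apply, smul_eq_mul, mul_assoc]

theorem weightedLoss_add_const (hX : MemLp X ∞ P) {Q : Fin d → Measure Ω}
    (hQ : Q ∈ vectorMeasures P d) (w z : Fin d → ℝ) :
    weightedLoss Q w (fun ω => X ω + z) = weightedLoss Q w X - w ⬝ᵥ z := by
  rw [weightedLoss, weightedLoss, dotProduct, ← Finset.sum_sub_distrib]
  refine Finset.sum_congr rfl fun i _ => ?_
  have := (hQ i).1
  have h1 : Integrable (fun ω => -X ω i) (Q i) :=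
    (integrable_of_memLp_top (hQ i).2 (memLp_apply hX i)).neg
  have h2 : ∫ ω, -(X ω + z) i ∂(Q i) = ∫ ω, (-X ω i + -z i) ∂(Q i) := by
    simp only [Pi.add_apply, neg_add]
  rw [h2, integral_add h1 (integrable_const _)]
  simp
  ring

theorem coe_le_of_forall_pos_sub_le {r : ℝ} {b : EReal}
    (h : ∀ ε > 0, ((r - ε : ℝ) : EReal) ≤ b) : (r : EReal) ≤ b := by
  refine le_of_forall_lt_imp_le_of_dense fun a ha => ?_
  obtain ⟨c, hac, hcr⟩ := EReal.lt_iff_exists_real_btwn.1 ha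
  have := h (r - c) (by linarith [EReal.coe_lt_coe_iff.1 hcr])
  rw [sub_sub_cancel] at this
  exact hac.le.trans this

theorem coe_le_sub_of_le {x y : ℝ} {p : EReal} (h : p ≤ ((y - x : ℝ) : EReal)) :
    (x : EReal) ≤ (y : EReal) - p :=
  calc (x : EReal) = (y : EReal) - ((y - x : ℝ) : EReal) := by
        rw [← EReal.coe_sub, sub_sub_cancel]
    _ ≤ _ := EReal.sub_le_sub le_rfl h

theorem sub_le_coe_of_le {x y : ℝ} {p : EReal} (h : ((y - x : ℝ) : EReal) ≤ p) :
    (y : EReal) - p ≤ (x : EReal) :=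
  calc (y : EReal) - p ≤ (y : EReal) - ((y - x : ℝ) : EReal) := EReal.sub_le_sub le_rfl h
    _ = x := by rw [← EReal.coe_sub, sub_sub_cancel]

/-- The dual representation of the insensitive systemic risk measure. -/
theorem rhoIns_eq_iSup [IsProbabilityMeasure P] (hρ : IsConvexRiskMeasure P ρ)
    (hΛ : IsAggregation Λ)
    (hpen : ∃ S ∈ equivMeasures P, penalty P ρ S < ⊤) (hX : MemLp X ∞ P) :
    (rhoIns ρ Λ X : EReal) = ⨆ Q ∈ vectorMeasures P d, ⨆ w ∈ weights d,
      (weightedLoss Q w X : EReal) - sysPenalty P ρ Λ Q w := by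
  refine le_antisymm (coe_le_of_forall_pos_sub_le fun ε hε => ?_) ?_
  · obtain ⟨v, hv, hmin⟩ := exists_weights_minorant hρ hΛ hX (half_pos hε)
    obtain ⟨Q, hQ, hle⟩ := hΛ.exists_sysPenalty_le hρ hpen hX hv.1 hmin (half_pos hε)
    refine le_iSup₂_of_le Q hQ (le_iSup₂_of_le v hv (coe_le_sub_of_le (hle.trans (le_of_eq ?_))))
    have : shiftedRisk ρ Λ X 0 = rhoIns ρ Λ X := by simp [shiftedRisk, rhoIns]
    rw [this]
    congr 1
    ring
  · exact iSup₂_le fun Q hQ => iSup₂_le fun w _ =>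
      sub_le_coe_of_le (weightedLoss_sub_rhoIns_le hρ hΛ hX hQ w)

/-- The dual representation of the scalarized sensitive systemic risk measure. -/
theorem rhoSen_eq_iSup [IsProbabilityMeasure P] (hρ : IsConvexRiskMeasure P ρ)
    (hΛ : IsAggregation Λ)
    (h0 : ρ (fun _ => 0) ∈ interior (Set.range Λ))
    (hpen : ∃ S ∈ equivMeasures P, penalty P ρ S < ⊤) {w : Fin d → ℝ} (hw : w ∈ weights d)
    (hX : MemLp X ∞ P) :
    rhoSen P ρ Λ w X = ⨆ Q ∈ vectorMeasures P d,
      (weightedLoss Q w X : EReal) - sysPenaltyHom P ρ Λ Q w := by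
  refine le_antisymm (le_of_forall_lt_imp_le_of_dense fun a ha => ?_) ?_
  · obtain ⟨c, hac, hc⟩ := EReal.lt_iff_exists_real_btwn.1 ha
    refine hac.le.trans (coe_le_of_forall_pos_sub_le fun ε hε => ?_)
    obtain ⟨μ, hμ, hmin⟩ := exists_multiplier hρ hΛ hX h0 hw (c := c) fun z hz => by
      have h1 : rhoSen P ρ Λ w X ≤ ((w ⬝ᵥ z : ℝ) : EReal) :=
        iInf₂_le z ⟨memLp_shifted hΛ hX z, hz⟩
      exact_mod_cast hc.le.trans h1
    have hcancel : ∀ r : ℝ, μ * (μ⁻¹ * r) = r := fun r => by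
      rw [← mul_assoc, mul_inv_cancel₀ hμ.ne', one_mul]
    -- Dividing the multiplier inequality by `μ` makes it an affine minorant of the shifted risk
    -- with slope `μ⁻¹ • w`.
    obtain ⟨Q, hQ, hle⟩ := hΛ.exists_sysPenalty_le hρ hpen hX (v := μ⁻¹ • w) (c := μ⁻¹ * c)
      (smul_nonneg (inv_nonneg.2 hμ.le) hw.1) (fun z => by
        refine le_of_mul_le_mul_left ?_ hμ
        rw [smul_dotProduct, smul_eq_mul, mul_sub, hcancel, hcancel]
        have := hmin z
        change c - w ⬝ᵥ z ≤ μ * shiftedRisk ρ Λ X z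
        linarith) (mul_pos (inv_pos.2 hμ) hε)
    refine le_iSup₂_of_le Q hQ (coe_le_sub_of_le ?_)
    refine (iInf_le _ (⟨μ⁻¹, inv_pos.2 hμ⟩ : {c : ℝ // 0 < c})).trans ?_
    rw [EReal.div_le_iff_le_mul (by exact_mod_cast inv_pos.2 hμ) (EReal.coe_ne_top _)]
    refine hle.trans (le_of_eq ?_)
    rw [weightedLoss_smul, ← EReal.coe_mul]
    congr 1
    ring
  · refine iSup₂_le fun Q hQ => le_iInf₂ fun z hz => sub_le_coe_of_le (le_iInf fun a => ?_)
    rw [EReal.le_div_iff_mul_le (by exact_mod_cast a.2) (EReal.coe_ne_top _)]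
    -- Weak duality for the acceptable position `X + z`, whose insensitive risk is at most zero.
    have h1 := weightedLoss_sub_rhoIns_le hρ hΛ (hX.add (memLp_const z)) hQ (a.1 • w)
    refine le_trans ?_ h1
    rw [← EReal.coe_mul, EReal.coe_le_coe_iff]
    have h2 : rhoIns ρ Λ (X + fun _ => z) ≤ 0 := hz.2
    have h3 : weightedLoss Q (a.1 • w) (X + fun _ => z) = a.1 * (weightedLoss Q w X - w ⬝ᵥ z) := by
      rw [weightedLoss_smul]
      exact congrArg _ (weightedLoss_add_const hX hQ w z)
    rw [h3]
    linarith

theorem isAggregation_two_mul_sum (hd : 0 < d) :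
    IsAggregation fun x : Fin d → ℝ => 2 * ∑ i, x i where
  increasing x z h := mul_le_mul_of_nonneg_left (Finset.sum_le_sum fun i _ => h i) zero_le_two
  concave x z γ _ _ := by
    simp only [Pi.add_apply, Pi.smul_apply, smul_eq_mul, Finset.sum_add_distrib, ← Finset.mul_sum]
    linarith
  nonconstant := by
    refine ⟨0, fun _ => 1, ?_⟩
    simp [hd.ne']

theorem exists_sum_eq (hd : 0 < d) (a : ℝ) : ∃ x : Fin d → ℝ, ∑ i, x i = a :=
  ⟨Pi.single ⟨0, hd⟩ a, by simp⟩

/-- For a linear aggregation function of slope two and constant positions, the sensitive risk is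
half of the insensitive one. -/
theorem rhoSen_two_mul_sum [IsProbabilityMeasure P] (hρ : IsConvexRiskMeasure P ρ)
    (hd : 0 < d) (x : Fin d → ℝ) :
    rhoSen P ρ (fun x : Fin d → ℝ => 2 * ∑ i, x i) (fun _ => 1) (fun _ => x) =
      (((ρ fun _ => 0) / 2 - ∑ i, x i : ℝ) : EReal) := by
  have hmem : ∀ z : Fin d → ℝ, z ∈ RSen P ρ (fun x : Fin d → ℝ => 2 * ∑ i, x i) (fun _ => x) ↔
      (ρ fun _ => 0) / 2 - ∑ i, x i ≤ ∑ i, z i := by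
    intro z
    have h1 : z ∈ RSen P ρ (fun x : Fin d → ℝ => 2 * ∑ i, x i) (fun _ => x) ↔
        (ρ fun _ => 2 * ∑ i, (x + z) i) ≤ 0 := ⟨fun h => h.2, fun h => ⟨memLp_const _, h⟩⟩
    rw [h1, hρ.const]
    simp only [Pi.add_apply, Finset.sum_add_distrib]
    constructor <;> intro h <;> linarith
  have hdot : ∀ z : Fin d → ℝ, (fun _ => 1) ⬝ᵥ z = ∑ i, z i := fun z => by simp [dotProduct]
  refine le_antisymm ?_ (le_iInf₂ fun z hz => ?_)
  · obtain ⟨z, hz⟩ := exists_sum_eq hd ((ρ fun _ => 0) / 2 - ∑ i, x i)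
    exact iInf₂_le_of_le z ((hmem z).2 hz.ge) (by rw [hdot, hz])
  · rw [hdot]
    exact_mod_cast (hmem z).1 hz

/-- The insensitive and the sensitive systemic risk measure differ in general. -/
theorem exists_rhoIns_ne_rhoSen [IsProbabilityMeasure P] (hρ : IsConvexRiskMeasure P ρ)
    (hd : 0 < d) :
    ∃ Λ : (Fin d → ℝ) → ℝ, IsAggregation Λ ∧ ρ (fun _ => 0) ∈ interior (Set.range Λ) ∧
      ∃ X : Ω → Fin d → ℝ, MemLp X ∞ P ∧
        (rhoIns ρ Λ X : EReal) ≠ rhoSen P ρ Λ (fun _ => 1) X := by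
  refine ⟨fun x => 2 * ∑ i, x i, isAggregation_two_mul_sum hd, ?_, ?_⟩
  · have : Set.range (fun x : Fin d → ℝ => 2 * ∑ i, x i) = Set.univ := by
      refine Set.eq_univ_of_forall fun r => ?_
      obtain ⟨x, hx⟩ := exists_sum_eq hd (r / 2)
      exact ⟨x, by simp only [hx]; ring⟩
    rw [this, interior_univ]
    trivial
  -- With this total the insensitive risk is `-2` and the sensitive one is `-1`.
  · obtain ⟨x, hx⟩ := exists_sum_eq hd ((ρ fun _ => 0) / 2 + 1)
    refine ⟨fun _ => x, memLp_const x, ?_⟩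
    rw [rhoSen_two_mul_sum hρ hd, rhoIns, hρ.const, hx, Ne, EReal.coe_eq_coe_iff]
    intro h
    linarith

end

end SystemicRisk

end

theorem corollary3p3 {Ω : Type*} [MeasurableSpace Ω] (P : Measure Ω) [IsProbabilityMeasure P]
    {d : ℕ} (hd : 0 < d) (ρ : (Ω → ℝ) → ℝ) (hρ : SystemicRisk.IsConvexRiskMeasure P ρ) :
    (∀ Λ : (Fin d → ℝ) → ℝ, SystemicRisk.IsAggregation Λ →
      ρ (fun _ => 0) ∈ interior (Set.range Λ) →
      (∃ S ∈ SystemicRisk.equivMeasures P, SystemicRisk.penalty P ρ S < ⊤) →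
      (∀ X : Ω → Fin d → ℝ, MemLp X ∞ P →
        (SystemicRisk.rhoIns ρ Λ X : EReal) =
          ⨆ Q ∈ SystemicRisk.vectorMeasures P d, ⨆ w ∈ SystemicRisk.weights d,
            (SystemicRisk.weightedLoss Q w X : EReal) - SystemicRisk.sysPenalty P ρ Λ Q w) ∧
      (∀ w ∈ SystemicRisk.weights d, ∀ X : Ω → Fin d → ℝ, MemLp X ∞ P →
        SystemicRisk.rhoSen P ρ Λ w X =
          ⨆ Q ∈ SystemicRisk.vectorMeasures P d,
            (SystemicRisk.weightedLoss Q w X : EReal) -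
              SystemicRisk.sysPenaltyHom P ρ Λ Q w)) ∧
    (∃ Λ : (Fin d → ℝ) → ℝ, SystemicRisk.IsAggregation Λ ∧
      ρ (fun _ => 0) ∈ interior (Set.range Λ) ∧
      ∃ X : Ω → Fin d → ℝ, MemLp X ∞ P ∧
        (SystemicRisk.rhoIns ρ Λ X : EReal) ≠
          SystemicRisk.rhoSen P ρ Λ (fun _ => 1) X) := by
  refine ⟨fun Λ hΛ h0 hpen => ⟨fun X hX => ?_, fun w hw X hX => ?_⟩, ?_⟩
  · exact SystemicRisk.rhoIns_eq_iSup hρ hΛ hpen hX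
  · exact SystemicRisk.rhoSen_eq_iSup hρ hΛ h0 hpen hw hX
  · exact SystemicRisk.exists_rhoIns_ne_rhoSen hρ hd
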